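/- **Conventions.** Manifolds are smooth, finite-dimensional, Hausdorff, second countable and without boundary. $\mathbb T=\{z\in\mathbb C:|z|=1\}$, $n\in\mathbb N_0$, and $\mathbb T^n$ is the $n$-torus with its product Lie group structure. For a manifold $P$, $C^\infty(P)$ is the unital algebra of smooth functions $P\to\mathbb C$ with its Fréchet topology of locally uniform convergence of all derivatives. For $p\in P$ let $\delta_p:C^\infty(P)\to\mathbb C$, $\delta_p(f)=f(p)$. A *smooth dynamical system* $(A,G,\alpha)$ consists of a unital locally convex algebra $A$ over $\mathbb{C}$, a Lie group $G$ and a group homomorphism $\alpha:G\to\operatorname{Aut}(A)$ such that $G\times A\to A$, $(g,a)\mapsto\alpha(g)a$ is smooth (in the Michal–Bastiani sense). For $G=\mathbb T^n$ and $\mathbf k\in\mathbb Z^n$ the isotypic component is $A_{\mathbf k}=\{a\in A:\alpha(z)a=z_1^{k_1}\cdots z_n^{k_n}\,a\ \text{for all } z\in\mathbb T^n\}$. A smooth dynamical system $(A,\mathbb T^n,\alpha)$ is a *smooth trivial NCP $\mathbb T^n$-bundle* if every $A_{\mathbf k}$, $\mathbf k\in\mathbb Z^n$, contains an invertible element of $A$.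 A *principal $G$-bundle* $(P,M,G,q,\sigma)$ consists of manifolds $P,M$, a smooth right action $\sigma:P\times G\to P$ and a smooth map $q:P\to M$ such that every $m\in M$ has an open neighbourhood $U$ with a diffeomorphism $\varphi_U:U\times G\to q^{-1}(U)$ satisfying $q\circ\varphi_U=\mathrm{pr}_U$ and $\varphi_U(u,gh)=\sigma(\varphi_U(u,g),h)$. It is *trivial* if there is a diffeomorphism $\varphi:P\to M\times G$ with $\mathrm{pr}_M\circ\varphi=q$ and $\varphi(\sigma(p,h))=\varphi(p)\cdot h$, where $(m,g)\cdot h=(m,gh)$. **Theorem (Trivial principal $\mathbb T^n$-bundles).** Let $P$ be a manifold. (a) Let $(C^\infty(P),\mathbb T^n,\alpha)$ be a smooth trivial NCP $\mathbb T^n$-bundle. Then there is a unique right action $\sigma$ of $\mathbb T^n$ on $P$ with $\delta_{\sigma(p,z)}=\delta_p\circ\alpha(z)$ for all $p\in P$, $z\in\mathbb T^n$. With the quotient topology, the orbit space $P/\mathbb T^n$ carries a manifold structure for which $(P,P/\mathbb T^n,\mathbb T^n,\mathrm{pr},\sigma)$, $\mathrm{pr}:P\to P/\mathbb T^n$ being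 the orbit map, is a principal bundle; and for every such structure this principal bundle is trivial. (b) Conversely, if $(P,M,\mathbb T^n,q,\sigma)$ is a trivial principal $\mathbb T^n$-bundle over a manifold $M$, then $(C^\infty(P),\mathbb T^n,\alpha)$ with $(\alpha(z)f)(p)=f(\sigma(p,z))$ is a smooth trivial NCP $\mathbb T^n$-bundle. -/

import Mathlib

open scoped Manifold ContDiff Topology

noncomputable section

universe u v

/-! ## Smooth maps between locally convex spaces -/

/-- `C^k`-maps on a subset `U` (meant to be open) of a real topological vector space, in the sense
of Michal and Bastiani: `f` is `C⁰` if it is continuous, and it is `C^(k+1)` if it is continuous,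
if all directional derivatives `df (x, h) = lim_{t → 0} (f (x + t h) - f x) / t` exist for `x ∈ U`,
and if `df : U × E → F` is `C^k`. -/
def LCContDiffOn : ℕ → ∀ {E : Type u} {F : Type v}
    [AddCommGroup E] [Module ℝ E] [TopologicalSpace E]
    [AddCommGroup F] [Module ℝ F] [TopologicalSpace F], (E → F) → Set E → Prop
  | 0, _, _, _, _, _, _, _, _, f, U => ContinuousOn f U
  | k + 1, E, F, _, _, _, _, _, _, f, U => ContinuousOn f U ∧ ∃ df : E × E → F,
      (∀ x ∈ U, ∀ h : E,
        Filter.Tendsto (fun t : ℝ => t⁻¹ • (f (x + t • h) - f x)) (𝓝[≠] 0) (𝓝 (df (x, h)))) ∧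
      LCContDiffOn k df (U ×ˢ (Set.univ : Set E))

/-- Smooth maps on an open subset of a locally convex space. -/
def LCSmoothOn {E : Type u} {F : Type v}
    [AddCommGroup E] [Module ℝ E] [TopologicalSpace E]
    [AddCommGroup F] [Module ℝ F] [TopologicalSpace F] (f : E → F) (U : Set E) : Prop :=
  ∀ k : ℕ, LCContDiffOn k f U

/-! ## Smooth dynamical systems -/

/-- A smooth dynamical system `(A, G, α)`: a homomorphism `α` from a Lie group `G` to the
automorphisms of a unital locally convex algebra `A` such that `G × A → A`, `(g, a) ↦ α g a`,
is smooth. Smoothness is expressed in the charts of `G`. -/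
def IsSmoothDynamicalSystem {E : Type u} [NormedAddCommGroup E] [NormedSpace ℝ E]
    {H : Type*} [TopologicalSpace H] (I : ModelWithCorners ℝ E H)
    {G : Type*} [Group G] [TopologicalSpace G] [ChartedSpace H G] [LieGroup I ∞ G]
    {A : Type v} [Ring A] [Algebra ℂ A] [Module ℝ A] [IsScalarTower ℝ ℂ A] [TopologicalSpace A]
    [IsTopologicalRing A] [ContinuousSMul ℂ A] [LocallyConvexSpace ℝ A]
    (α : G →* (A ≃ₐ[ℂ] A)) : Prop :=
  ∀ g₀ : G, LCSmoothOn (fun x : E × A => α ((extChartAt I g₀).symm x.1) x.2)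
    ((extChartAt I g₀).target ×ˢ Set.univ)

/-- The torus `𝕋ⁿ`, with the product group structure and the product manifold structure. -/
abbrev Torus (n : ℕ) : Type := Fin n → Circle

/-- The model with corners of the torus. -/
abbrev torusModel (n : ℕ) :
    ModelWithCorners ℝ (Fin n → EuclideanSpace ℝ (Fin 1))
      (ModelPi fun _ : Fin n => EuclideanSpace ℝ (Fin 1)) :=
  ModelWithCorners.pi fun _ => 𝓡 1

theorem Torus.contMDiff_apply (n : ℕ) (i : Fin n) :
    ContMDiff (torusModel n) (𝓡 1) ∞ (fun z : Torus n => z i) := by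
  intro z
  rw [contMDiffAt_iff]
  refine ⟨(continuous_apply i).continuousAt, ?_⟩
  have h : ContDiffWithinAt ℝ ∞ (fun x : Fin n → EuclideanSpace ℝ (Fin 1) => x i)
      (Set.range (torusModel n)) (extChartAt (torusModel n) z z) :=
    (contDiff_apply ℝ _ i).contDiffWithinAt
  refine h.congr_of_eventuallyEq ?_ ?_
  · filter_upwards [extChartAt_target_mem_nhdsWithin (I := torusModel n) z] with x hx
    exact congrFun ((extChartAt (torusModel n) z).right_inv hx) i
  · exact congrFun ((extChartAt (torusModel n) z).right_inv
      ((extChartAt (torusModel n) z).map_source (mem_extChartAt_source z))) i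

theorem Torus.contMDiff_of_apply {n : ℕ} {E : Type*} [NormedAddCommGroup E] [NormedSpace ℝ E]
    {H : Type*} [TopologicalSpace H] {I : ModelWithCorners ℝ E H} {M : Type*} [TopologicalSpace M]
    [ChartedSpace H M] {f : M → Torus n} (hf : ∀ i, ContMDiff I (𝓡 1) ∞ fun x => f x i) :
    ContMDiff I (torusModel n) ∞ f := by
  intro x
  rw [contMDiffAt_iff]
  refine ⟨(continuous_pi fun i => (hf i).continuous).continuousAt, ?_⟩
  exact contDiffWithinAt_pi.2 fun i => ((contMDiffAt_iff (x := x)).1 (hf i x)).2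

instance Torus.instIsManifold (n : ℕ) : IsManifold (torusModel n) ∞ (Torus n) := by
  refine isManifold_of_contDiffOn _ _ _ ?_
  rintro _ _ ⟨e, he, rfl⟩ ⟨e', he', rfl⟩
  refine contDiffOn_pi.2 fun i => ?_
  have h := ((contDiffGroupoid ∞ (𝓡 1)).compatible (he i trivial) (he' i trivial))
  rw [contDiffGroupoid, mem_groupoid_of_pregroupoid] at h
  have h1 := h.1
  change ContDiffOn ℝ ∞ _ _ at h1
  have h2 := h1.comp (s := ((torusModel n).symm ⁻¹' ((OpenPartialHomeomorph.pi e).symm.trans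
      (OpenPartialHomeomorph.pi e')).source ∩ Set.range (torusModel n)))
    (contDiff_apply ℝ (EuclideanSpace ℝ (Fin 1)) i).contDiffOn ?_
  · exact h2
  · rintro x ⟨hx, -⟩
    refine ⟨⟨hx.1 i trivial, hx.2 i trivial⟩, x i, rfl⟩

instance Torus.instLieGroup (n : ℕ) : LieGroup (torusModel n) ∞ (Torus n) where
  contMDiff_mul := Torus.contMDiff_of_apply fun i =>
    ContMDiff.mul (G := Circle) ((Torus.contMDiff_apply n i).comp contMDiff_fst)
      ((Torus.contMDiff_apply n i).comp contMDiff_snd)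
  contMDiff_inv := Torus.contMDiff_of_apply fun i => (Torus.contMDiff_apply n i).inv

/-- The character `z ↦ z^k = z₁^k₁ ⋯ zₙ^kₙ` of `𝕋ⁿ`. -/
def torusChar {n : ℕ} (k : Fin n → ℤ) (z : Torus n) : ℂ := ∏ i, (z i : ℂ) ^ k i

/-- The isotypic component `A_k = {a | ∀ z, α(z) a = z^k a}`. -/
def torusIsotypic {n : ℕ} {A : Type*} [Ring A] [Algebra ℂ A]
    (α : Torus n →* (A ≃ₐ[ℂ] A)) (k : Fin n → ℤ) : Submodule ℂ A where
  carrier := {a | ∀ z, α z a = torusChar k z • a}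
  add_mem' ha hb z := by rw [map_add, ha z, hb z, smul_add]
  zero_mem' z := by rw [map_zero, smul_zero]
  smul_mem' c a ha z := by rw [map_smul, ha z, smul_comm]

/-- A smooth trivial NCP `𝕋ⁿ`-bundle: a smooth dynamical system `(A, 𝕋ⁿ, α)` each of whose
isotypic components contains an invertible element. -/
structure IsSmoothTrivialNCPTorusBundle {n : ℕ}
    {A : Type v} [Ring A] [Algebra ℂ A] [Module ℝ A] [IsScalarTower ℝ ℂ A] [TopologicalSpace A]
    [IsTopologicalRing A] [ContinuousSMul ℂ A] [LocallyConvexSpace ℝ A]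
    (α : Torus n →* (A ≃ₐ[ℂ] A)) : Prop where
  smooth : IsSmoothDynamicalSystem (torusModel n) α
  exists_isUnit : ∀ k : Fin n → ℤ, ∃ a ∈ torusIsotypic α k, IsUnit a

/-! ## The locally convex algebra of smooth functions -/

/-- Multiplication of complex numbers is smooth over `ℝ`, so that `C^∞(P)` is a ring. -/
instance instContMDiffRingComplex : ContMDiffRing 𝓘(ℝ, ℂ) ∞ ℂ where
  contMDiff_mul := by
    rw [← modelWithCornersSelf_prod, chartedSpaceSelf_prod]
    exact (contDiff_mul (𝕜 := ℝ) (𝔸 := ℂ)).contMDiff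

section SmoothFn

variable (d : ℕ) (P : Type u) [TopologicalSpace P] [ChartedSpace (EuclideanSpace ℝ (Fin d)) P]

/-- The algebra `C^∞(P)` of smooth complex-valued functions on a manifold `P`. -/
abbrev SmoothFn : Type u := C^∞⟮𝓡 d, P; 𝓘(ℝ, ℂ), ℂ⟯

variable {d P}

/-- The pointwise complex algebra structure of `C^∞(P)`. -/
instance SmoothFn.instAlgebra : Algebra ℂ (SmoothFn d P) where
  smul c f := ⟨fun p => c * f p, contMDiff_const.mul f.contMDiff⟩
  algebraMap :=
    { toFun := fun c => ⟨fun _ => c, contMDiff_const⟩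
      map_one' := rfl
      map_mul' := fun _ _ => rfl
      map_zero' := rfl
      map_add' := fun _ _ => rfl }
  commutes' c f := by ext p; exact mul_comm _ _
  smul_def' c f := rfl

theorem SmoothFn.smul_apply (c : ℂ) (f : SmoothFn d P) (p : P) : (c • f) p = c * f p := rfl

theorem SmoothFn.contDiffAt [IsManifold (𝓡 d) ∞ P] (f : SmoothFn d P)
    {e : OpenPartialHomeomorph P (EuclideanSpace ℝ (Fin d))}
    (he : e ∈ atlas (EuclideanSpace ℝ (Fin d)) P) {x : EuclideanSpace ℝ (Fin d)}
    (hx : x ∈ e.target) : ContDiffAt ℝ ∞ (f ∘ e.symm) x := by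
  have h := contMDiffOn_symm_of_mem_maximalAtlas (I := 𝓡 d) (n := ∞)
    (IsManifold.subset_maximalAtlas he)
  exact (f.contMDiff.comp_contMDiffOn h).contDiffOn.contDiffAt (e.open_target.mem_nhds hx)

/-- Index set of the seminorms: a chart `e` of `P`, a compact subset `K` of its image in `ℝ^d`,
and an order of differentiation. -/
structure ChartIndex (d : ℕ) (P : Type u) [TopologicalSpace P]
    [ChartedSpace (EuclideanSpace ℝ (Fin d)) P] where
  chart : OpenPartialHomeomorph P (EuclideanSpace ℝ (Fin d))
  chart_mem : chart ∈ atlas (EuclideanSpace ℝ (Fin d)) P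
  K : Set (EuclideanSpace ℝ (Fin d))
  isCompact : IsCompact K
  subset_target : K ⊆ chart.target
  order : ℕ

theorem SmoothFn.bddAbove [IsManifold (𝓡 d) ∞ P] (i : ChartIndex d P) (f : SmoothFn d P) :
    BddAbove (Set.range fun x : i.K => ‖iteratedFDeriv ℝ i.order (f ∘ i.chart.symm) x‖) := by
  have hc : ContinuousOn (fun x => ‖iteratedFDeriv ℝ i.order (f ∘ i.chart.symm) x‖) i.K :=
    fun x hx => (((f.contDiffAt i.chart_mem (i.subset_target hx)).continuousAt_iteratedFDeriv
      (by exact_mod_cast le_top)).norm).continuousWithinAt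
  have := i.isCompact.bddAbove_image hc
  rwa [Set.image_eq_range] at this

/-- The seminorm `f ↦ sup_{x ∈ K} ‖D^k (f ∘ e⁻¹)(x)‖`. -/
def SmoothFn.chartSeminorm [IsManifold (𝓡 d) ∞ P] (i : ChartIndex d P) :
    Seminorm ℂ (SmoothFn d P) :=
  Seminorm.of (fun f => ⨆ x : i.K, ‖iteratedFDeriv ℝ i.order (f ∘ i.chart.symm) x‖)
    (fun f g => by
      refine Real.iSup_le (fun x => ?_)
        (add_nonneg (Real.iSup_nonneg fun _ => norm_nonneg _)
          (Real.iSup_nonneg fun _ => norm_nonneg _))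
      have hf := (f.contDiffAt i.chart_mem (i.subset_target x.2)).of_le
        (m := i.order) (by exact_mod_cast le_top)
      have hg := (g.contDiffAt i.chart_mem (i.subset_target x.2)).of_le
        (m := i.order) (by exact_mod_cast le_top)
      have h : iteratedFDeriv ℝ i.order (⇑(f + g) ∘ i.chart.symm) x =
          iteratedFDeriv ℝ i.order (f ∘ i.chart.symm) x +
            iteratedFDeriv ℝ i.order (g ∘ i.chart.symm) x :=
        iteratedFDeriv_add_apply hf hg
      rw [h]
      exact (norm_add_le _ _).trans
        (add_le_add (le_ciSup (f.bddAbove i) x) (le_ciSup (g.bddAbove i) x)))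
    (fun c f => by
      rw [Real.mul_iSup_of_nonneg (norm_nonneg c)]
      congr 1
      ext x
      have hf := (f.contDiffAt i.chart_mem (i.subset_target x.2)).of_le
        (m := i.order) (by exact_mod_cast le_top)
      have h : iteratedFDeriv ℝ i.order (⇑(c • f) ∘ i.chart.symm) x =
          c • iteratedFDeriv ℝ i.order (f ∘ i.chart.symm) x :=
        iteratedFDeriv_const_smul_apply (a := c) hf
      rw [h, norm_smul])

/-- The family of all seminorms `f ↦ sup_{x ∈ K} ‖D^k (f ∘ e⁻¹)(x)‖`. -/
def SmoothFn.seminormFamily (d : ℕ) (P : Type u) [TopologicalSpace P]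
    [ChartedSpace (EuclideanSpace ℝ (Fin d)) P] [IsManifold (𝓡 d) ∞ P] :
    SeminormFamily ℂ (SmoothFn d P) (ChartIndex d P) :=
  SmoothFn.chartSeminorm

variable [IsManifold (𝓡 d) ∞ P]

/-- The usual Fréchet topology of `C^∞(P)`, that is, locally uniform convergence of all
derivatives in charts (the smooth compact-open topology). -/
instance SmoothFn.instTopologicalSpace : TopologicalSpace (SmoothFn d P) :=
  (SmoothFn.seminormFamily d P).moduleFilterBasis.topology

theorem SmoothFn.withSeminorms : WithSeminorms (SmoothFn.seminormFamily d P) := ⟨rfl⟩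

instance SmoothFn.instIsScalarTower : IsScalarTower ℝ ℂ (SmoothFn d P) :=
  ⟨fun r c f => by
    ext p
    exact smul_mul_assoc r c (f p)⟩

instance SmoothFn.instContinuousSMul : ContinuousSMul ℂ (SmoothFn d P) :=
  SmoothFn.withSeminorms.continuousSMul

instance SmoothFn.instLocallyConvexSpace : LocallyConvexSpace ℝ (SmoothFn d P) :=
  SmoothFn.withSeminorms.toLocallyConvexSpace

theorem SmoothFn.le_chartSeminorm (i : ChartIndex d P) (f : SmoothFn d P)
    {x : EuclideanSpace ℝ (Fin d)} (hx : x ∈ i.K) :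
    ‖iteratedFDeriv ℝ i.order (f ∘ i.chart.symm) x‖ ≤ SmoothFn.chartSeminorm i f :=
  le_ciSup (f.bddAbove i) (⟨x, hx⟩ : i.K)

theorem SmoothFn.chartSeminorm_mul_le (i : ChartIndex d P) (f g : SmoothFn d P) :
    SmoothFn.chartSeminorm i (f * g) ≤ ∑ j ∈ Finset.range (i.order + 1),
      (i.order.choose j : ℝ) * SmoothFn.chartSeminorm { i with order := j } f *
        SmoothFn.chartSeminorm { i with order := i.order - j } g := by
  refine Real.iSup_le (fun x => ?_) (Finset.sum_nonneg fun j _ => by positivity)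
  have hxt := i.subset_target x.2
  have hf : ContDiffOn ℝ ∞ (f ∘ i.chart.symm) i.chart.target :=
    fun y hy => (f.contDiffAt i.chart_mem hy).contDiffWithinAt
  have hg : ContDiffOn ℝ ∞ (g ∘ i.chart.symm) i.chart.target :=
    fun y hy => (g.contDiffAt i.chart_mem hy).contDiffWithinAt
  have h := norm_iteratedFDerivWithin_mul_le (n := i.order) hf hg
    i.chart.open_target.uniqueDiffOn hxt (by exact_mod_cast le_top)
  rw [iteratedFDerivWithin_of_isOpen _ i.chart.open_target hxt] at h
  refine (le_of_eq_of_le rfl h).trans (Finset.sum_le_sum fun j _ => ?_)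
  rw [iteratedFDerivWithin_of_isOpen _ i.chart.open_target hxt,
    iteratedFDerivWithin_of_isOpen _ i.chart.open_target hxt]
  have h1 := SmoothFn.le_chartSeminorm { i with order := j } f x.2
  have h2 := SmoothFn.le_chartSeminorm { i with order := i.order - j } g x.2
  have h3 : (0 : ℝ) ≤ SmoothFn.chartSeminorm { i with order := j } f := apply_nonneg _ _
  gcongr

instance SmoothFn.instIsTopologicalRing : IsTopologicalRing (SmoothFn d P) := by
  have hw := SmoothFn.withSeminorms (d := d) (P := P)
  have := hw.topologicalAddGroup
  have hc : ∀ i : ChartIndex d P, Continuous (SmoothFn.chartSeminorm i) :=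
    fun i => hw.continuous_seminorm i
  have key : ∀ f₀ g₀ : SmoothFn d P, f₀ = 0 ∨ g₀ = 0 →
      Filter.Tendsto (fun p : SmoothFn d P × SmoothFn d P => p.1 * p.2) (𝓝 (f₀, g₀)) (𝓝 0) := by
    intro f₀ g₀ h₀
    refine (hw.tendsto_nhds _ _).2 fun i ε hε => ?_
    have hb : Continuous (fun p : SmoothFn d P × SmoothFn d P =>
        ∑ j ∈ Finset.range (i.order + 1), (i.order.choose j : ℝ) *
          SmoothFn.chartSeminorm { i with order := j } p.1 *
          SmoothFn.chartSeminorm { i with order := i.order - j } p.2) :=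
      continuous_finsetSum _ fun j _ =>
        (continuous_const.mul ((hc _).comp continuous_fst)).mul ((hc _).comp continuous_snd)
    have ht := hb.tendsto (f₀, g₀)
    rw [Finset.sum_eq_zero (fun j _ => by rcases h₀ with rfl | rfl <;> simp)] at ht
    filter_upwards [ht.eventually (gt_mem_nhds hε)] with p hp
    rw [sub_zero]
    exact (SmoothFn.chartSeminorm_mul_le i p.1 p.2).trans_lt hp
  refine IsTopologicalRing.of_addGroup_of_nhds_zero ?_ (fun x₀ => ?_) (fun x₀ => ?_)
  · rw [← nhds_prod_eq]
    exact key 0 0 (Or.inl rfl)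
  · exact (key x₀ 0 (Or.inr rfl)).comp
      ((continuous_const.prodMk continuous_id).tendsto' 0 (x₀, 0) rfl)
  · exact (key 0 x₀ (Or.inl rfl)).comp
      ((continuous_id.prodMk continuous_const).tendsto' 0 (0, x₀) rfl)

end SmoothFn

/-! ## Principal bundles -/

/-- A right action `σ : P × G → P` of a group on a set. -/
@[ext]
structure RightAction (P : Type*) (G : Type*) [Group G] where
  act : P → G → P
  act_one : ∀ p, act p 1 = p
  act_mul : ∀ p g h, act p (g * h) = act (act p g) h

namespace RightAction

variable {P : Type*} {G : Type*} [Group G]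

/-- The equivalence relation on `P` whose classes are the orbits of `σ`. -/
def orbitSetoid (σ : RightAction P G) : Setoid P where
  r p q := ∃ g, σ.act p g = q
  iseqv :=
    { refl := fun p => ⟨1, σ.act_one p⟩
      symm := by
        rintro p q ⟨g, rfl⟩
        exact ⟨g⁻¹, by rw [← σ.act_mul, mul_inv_cancel, σ.act_one]⟩
      trans := by
        rintro p q r ⟨g, rfl⟩ ⟨h, rfl⟩
        exact ⟨g * h, σ.act_mul p g h⟩ }

/-- The orbit space `P/G`. -/
def OrbitSpace (σ : RightAction P G) : Type _ := Quotient σ.orbitSetoid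

/-- The orbit map `pr : P → P/G`. -/
def orbitMap (σ : RightAction P G) : P → σ.OrbitSpace := Quotient.mk σ.orbitSetoid

/-- The orbit space carries the quotient topology. -/
instance [TopologicalSpace P] (σ : RightAction P G) : TopologicalSpace σ.OrbitSpace :=
  inferInstanceAs (TopologicalSpace (Quotient σ.orbitSetoid))

/-- The right action `σ_G ((m, g), h) = (m, g h)` on `M × G`. -/
def trivial (M G : Type*) [Group G] : RightAction (M × G) G where
  act x h := (x.1, x.2 * h)
  act_one x := by rw [mul_one]
  act_mul x g h := by rw [mul_assoc]

end RightAction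

section PrincipalBundle

variable {EP : Type*} [NormedAddCommGroup EP] [NormedSpace ℝ EP] {HP : Type*} [TopologicalSpace HP]
  (IP : ModelWithCorners ℝ EP HP) {P : Type*} [TopologicalSpace P] [ChartedSpace HP P]
  {EM : Type*} [NormedAddCommGroup EM] [NormedSpace ℝ EM] {HM : Type*} [TopologicalSpace HM]
  (IM : ModelWithCorners ℝ EM HM) {M : Type*} [TopologicalSpace M] [ChartedSpace HM M]
  {EG : Type*} [NormedAddCommGroup EG] [NormedSpace ℝ EG] {HG : Type*} [TopologicalSpace HG]
  (IG : ModelWithCorners ℝ EG HG) {G : Type*} [Group G] [TopologicalSpace G] [ChartedSpace HG G]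

/-- A smooth right action of a Lie group on a manifold. -/
def RightAction.IsSmooth (σ : RightAction P G) : Prop :=
  ContMDiff (IP.prod IG) IP ∞ fun x : P × G => σ.act x.1 x.2

/-- `(P, M, G, q, σ)` is a smooth principal bundle. -/
structure IsPrincipalBundle (q : P → M) (σ : RightAction P G) : Prop where
  smooth_act : σ.IsSmooth IP IG
  smooth_proj : ContMDiff IP IM ∞ q
  locallyTrivial : ∀ m : M, ∃ (U : TopologicalSpace.Opens M) (V : TopologicalSpace.Opens P),
    m ∈ U ∧ (V : Set P) = q ⁻¹' U ∧
    ∃ φ : Diffeomorph (IM.prod IG) IP (U × G) V ∞,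
      (∀ u g, q (φ (u, g)) = u) ∧
      ∀ u g h, (φ (u, g * h) : P) = σ.act (φ (u, g)) h

/-- The principal `G`-bundles `(P, M, G, q, σ)` and `(P', M, G, q', σ')` over `M` are equivalent:
there is a `G`-equivariant diffeomorphism `P → P'` over the identity of `M`. -/
def BundleEquivalent {EP' : Type*} [NormedAddCommGroup EP'] [NormedSpace ℝ EP']
    {HP' : Type*} [TopologicalSpace HP'] (IP' : ModelWithCorners ℝ EP' HP')
    {P' : Type*} [TopologicalSpace P'] [ChartedSpace HP' P']
    (q : P → M) (σ : RightAction P G) (q' : P' → M) (σ' : RightAction P' G) : Prop :=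
  ∃ φ : Diffeomorph IP IP' P P' ∞,
    (∀ p, q' (φ p) = q p) ∧ ∀ p g, φ (σ.act p g) = σ'.act (φ p) g

/-- The principal bundle `(P, M, G, q, σ)` is trivial: it is a principal bundle that is equivalent
to `(M × G, M, G, pr₁, σ_G)`. -/
def IsTrivialPrincipalBundle (q : P → M) (σ : RightAction P G) : Prop :=
  IsPrincipalBundle IP IM IG q σ ∧
    BundleEquivalent IP (IM.prod IG) q σ Prod.fst (RightAction.trivial M G)

end PrincipalBundle

/-! ## Actions on `P` and on `C^∞(P)` -/

section Induced

variable {d : ℕ} {P : Type u} [TopologicalSpace P] [ChartedSpace (EuclideanSpace ℝ (Fin d)) P]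

/-- The character `δ_p : C^∞(P) → ℂ`, `f ↦ f p`. -/
def evalChar (p : P) : SmoothFn d P →ₐ[ℂ] ℂ where
  toFun f := f p
  map_one' := rfl
  map_mul' _ _ := rfl
  map_zero' := rfl
  map_add' _ _ := rfl
  commutes' _ := rfl

/-- `σ` is the right action on `P` induced by an action `α` of `G` on `C^∞(P)`: under the
identification of `p` with the character `δ_p` it is given by `(δ_p, g) ↦ δ_p ∘ α(g)`. -/
def IsInducedAction {G : Type*} [Group G] (α : G →* (SmoothFn d P ≃ₐ[ℂ] SmoothFn d P))
    (σ : RightAction P G) : Prop :=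
  ∀ p g, evalChar (σ.act p g) = (evalChar p).comp (α g : SmoothFn d P →ₐ[ℂ] SmoothFn d P)

variable {EG : Type*} [NormedAddCommGroup EG] [NormedSpace ℝ EG] {HG : Type*} [TopologicalSpace HG]
  {IG : ModelWithCorners ℝ EG HG} {G : Type*} [Group G] [TopologicalSpace G] [ChartedSpace HG G]

theorem RightAction.IsSmooth.contMDiff_act {σ : RightAction P G} (hσ : σ.IsSmooth (𝓡 d) IG)
    (g : G) : ContMDiff (𝓡 d) (𝓡 d) ∞ fun p => σ.act p g :=
  ContMDiff.comp (g := fun x : P × G => σ.act x.1 x.2) (f := fun p => (p, g)) hσ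
    (contMDiff_id.prodMk contMDiff_const)

/-- The action of `G` on `C^∞(P)` induced by a smooth right action `σ` on `P`:
`(α(g) f)(p) = f (σ (p, g))`. -/
def functionAction (σ : RightAction P G) (hσ : σ.IsSmooth (𝓡 d) IG) :
    G →* (SmoothFn d P ≃ₐ[ℂ] SmoothFn d P) where
  toFun g :=
    { toFun := fun f => f.comp ⟨fun p => σ.act p g, hσ.contMDiff_act g⟩
      invFun := fun f => f.comp ⟨fun p => σ.act p g⁻¹, hσ.contMDiff_act g⁻¹⟩
      left_inv := fun f => by
        ext p
        change f (σ.act (σ.act p g⁻¹) g) = f p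
        rw [← σ.act_mul, inv_mul_cancel, σ.act_one]
      right_inv := fun f => by
        ext p
        change f (σ.act (σ.act p g) g⁻¹) = f p
        rw [← σ.act_mul, mul_inv_cancel, σ.act_one]
      map_mul' := fun _ _ => rfl
      map_add' := fun _ _ => rfl
      commutes' := fun _ => rfl }
  map_one' := by
    ext f p
    change f (σ.act p 1) = f p
    rw [σ.act_one]
  map_mul' g h := by
    ext f p
    change f (σ.act p (g * h)) = f (σ.act (σ.act p g) h)
    rw [σ.act_mul]

end Induced

end

/-! For (a), every character of `C^∞(P)` is a point evaluation (`exists_eq_evalChar`), so `δ_p ∘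
α(z)` is evaluation at a unique point, which defines `σ`. It is smooth because a map into `P` is
smooth once its compositions with all smooth functions are (`contMDiff_of_forall_smoothFn`), and `f
(σ (p, z)) = (α(z) f) (p)`. Joint smoothness of the right-hand side is an exponential law. It is
proved only along affine lines (`LCSmoothOn.contMDiff_line`), which suffices because the circle is
one-dimensional and the torus acts through its circle factors one after the other.

Invertible elements `w_i` of the isotypic components of the unit vectors give, after normalization,
a smooth equivariant map `v = (w_i / |w_i|) : P → 𝕋ⁿ`. Every orbit meets `v⁻¹(1)` in exactly one
point, `σ (p, v(p)⁻¹)`; this defines a global section `ρ` of the orbit map. The imaginary parts of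
`v` form a submersion along `v⁻¹(1)`, so the inverse function theorem makes this set a slice, and
its coordinates are the charts of the orbit space. For any principal bundle structure on the orbit
space `ρ` is smooth, and `(pr, v)` is a trivialization with inverse `(m, g) ↦ σ (ρ m, g)`.

For (b), the character `z ↦ z^k` of the fibre coordinate is an invertible element of degree `k`.
Smoothness of the action is the analytic part. Charts of the torus lift to angles, so the action
becomes `(x, f) ↦ β(Θ x) f` for a family `β` of pull-backs. This family is jointly continuous and
has continuous generators `X_i`. Differentiating `b · β(T) v` yields a sum of terms of the same
form, and smoothness follows by induction (`lcContDiffOn_of_generators`). -/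

noncomputable section

/-! ### Iterated derivatives of functions on a product, in one factor -/

section Slice

variable {W E F : Type*} [NormedAddCommGroup W] [NormedSpace ℝ W] [NormedAddCommGroup E]
  [NormedSpace ℝ E] [NormedAddCommGroup F] [NormedSpace ℝ F]

/-- Iterated derivatives of a slice `G (w, ·)` are restrictions of iterated derivatives of `G`. -/
theorem iteratedFDeriv_slice {G : W × E → F} {s : Set E} (hs : IsOpen s)
    (hG : ContDiffOn ℝ ∞ G (Set.univ ×ˢ s)) (k : ℕ) (w : W) {y : E} (hy : y ∈ s) :
    iteratedFDeriv ℝ k (fun y => G (w, y)) y =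
      (iteratedFDeriv ℝ k G (w, y)).compContinuousLinearMap
        fun _ => ContinuousLinearMap.inr ℝ W E := by
  have hS : IsOpen (Set.univ ×ˢ s : Set (W × E)) := isOpen_univ.prod hs
  have hpre : ContinuousLinearMap.inr ℝ W E ⁻¹' (Set.univ ×ˢ s) = s := by ext; simp
  -- The slice `y ↦ (w, y)` is only affine. Translation by `(w, 0)` reduces it to the linear map
  -- `inr`, for which the composition rule is available.
  have hG' : ContDiffOn ℝ ∞ (fun z => G ((w, 0) + z)) (Set.univ ×ˢ s) :=
    hG.comp (contDiff_const.add contDiff_id).contDiffOn fun z hz => by simpa using hz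
  have h := (ContinuousLinearMap.inr ℝ W E).iteratedFDerivWithin_comp_right hG' hS.uniqueDiffOn
    (by rw [hpre]; exact hs.uniqueDiffOn) (x := y) (by simpa using hy) (i := k)
    (by exact_mod_cast le_top)
  rw [hpre, iteratedFDerivWithin_of_isOpen k hs hy,
    iteratedFDerivWithin_of_isOpen k hS (by simpa using hy), iteratedFDeriv_comp_add_left'] at h
  have h1 : (fun z => G ((w, 0) + z)) ∘ (ContinuousLinearMap.inr ℝ W E) = fun y => G (w, y) := by
    ext; simp
  rw [h1] at h
  simpa using h

theorem ContDiffOn.iteratedFDeriv_of_isOpen {G : E → F} {s : Set E} (hs : IsOpen s)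
    (hG : ContDiffOn ℝ ∞ G s) (k : ℕ) : ContDiffOn ℝ ∞ (iteratedFDeriv ℝ k G) s := by
  intro x hx
  refine ContDiffAt.contDiffWithinAt ?_
  exact (hG.contDiffAt (hs.mem_nhds hx)).iteratedFDeriv_right (m := ∞) (n := ∞)
    (by exact_mod_cast le_top)

theorem norm_iteratedFDeriv_slice_le {G : W × E → F} {s : Set E} (hs : IsOpen s)
    (hG : ContDiffOn ℝ ∞ G (Set.univ ×ˢ s)) (k : ℕ) (w : W) {y : E} (hy : y ∈ s) :
    ‖iteratedFDeriv ℝ k (fun y => G (w, y)) y‖ ≤ ‖iteratedFDeriv ℝ k G (w, y)‖ := by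
  rw [iteratedFDeriv_slice hs hG k w hy]
  refine (ContinuousMultilinearMap.norm_compContinuousLinearMap_le _ _).trans ?_
  refine mul_le_of_le_one_right (norm_nonneg _) (Finset.prod_le_one (fun _ _ => norm_nonneg _)
    fun _ _ => ContinuousLinearMap.norm_inr_le_one ℝ W E)

theorem continuousOn_iteratedFDeriv_slice {G : W × E → F} {s : Set E} (hs : IsOpen s)
    (hG : ContDiffOn ℝ ∞ G (Set.univ ×ˢ s)) (k : ℕ) :
    ContinuousOn (fun z : W × E => iteratedFDeriv ℝ k (fun y => G (z.1, y)) z.2)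
      (Set.univ ×ˢ s) := by
  have h := (hG.iteratedFDeriv_of_isOpen (isOpen_univ.prod hs) k).continuousOn
  refine ((ContinuousMultilinearMap.compContinuousLinearMapL (F := F)
    (fun _ : Fin k => ContinuousLinearMap.inr ℝ W E)).continuous.comp_continuousOn h).congr ?_
  rintro ⟨w, y⟩ hz
  exact iteratedFDeriv_slice hs hG k w hz.2

/-- The derivative in a fixed direction commutes with iterated derivatives. -/
theorem fderiv_iteratedFDeriv_apply {G : E → F} {s : Set E} (hs : IsOpen s)
    (hG : ContDiffOn ℝ ∞ G s) (k : ℕ) (a : E) {x : E} (hx : x ∈ s) :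
    fderiv ℝ (iteratedFDeriv ℝ k G) x a = iteratedFDeriv ℝ k (fun z => fderiv ℝ G z a) x := by
  induction k generalizing x with
  | zero =>
    ext m
    rw [iteratedFDeriv_zero_eq_comp, iteratedFDeriv_zero_apply]
    rw [LinearIsometryEquiv.comp_fderiv]
    rfl
  | succ k ih =>
    have hD := hG.iteratedFDeriv_of_isOpen hs k
    have hDa := hD.contDiffAt (hs.mem_nhds hx)
    -- Symmetry of the second derivative of `D^k G` exchanges the direction `a` with the first slot
    -- `m 0`; the induction hypothesis is then differentiated as an identity of germs at `x`.
    have hsymm : IsSymmSndFDerivAt ℝ (iteratedFDeriv ℝ k G) x :=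
      hDa.isSymmSndFDerivAt (by simpa using ENat.LEInfty.out)
    have hd : DifferentiableAt ℝ (fderiv ℝ (iteratedFDeriv ℝ k G)) x :=
      (hDa.fderiv_right (m := 1) (by norm_cast)).differentiableAt one_ne_zero
    ext m
    have h1 : fderiv ℝ (iteratedFDeriv ℝ (k + 1) G) x a m =
        fderiv ℝ (fderiv ℝ (iteratedFDeriv ℝ k G)) x a (m 0) (Fin.tail m) := by
      have hx1 : DifferentiableAt ℝ (iteratedFDeriv ℝ (k + 1) G) x :=
        ((hG.iteratedFDeriv_of_isOpen hs (k + 1)).contDiffAt (hs.mem_nhds hx)).differentiableAt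
          (by simp)
      have e1 := ((ContinuousMultilinearMap.apply ℝ (fun _ : Fin (k + 1) => E) F
        m).hasFDerivAt.comp x hx1.hasFDerivAt)
      have e2 := ((ContinuousMultilinearMap.apply ℝ (fun _ : Fin k => E) F
        (Fin.tail m)).hasFDerivAt.comp x
          (hd.hasFDerivAt.clm_apply (hasFDerivAt_const (m 0) x)))
      have h := congrArg (fun L : E →L[ℝ] F => L a) (e1.unique e2)
      simpa using h
    rw [h1, hsymm a (m 0), iteratedFDeriv_succ_apply_left]
    have h2 : iteratedFDeriv ℝ k (fun z => fderiv ℝ G z a) =ᶠ[𝓝 x]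
        fun y => fderiv ℝ (iteratedFDeriv ℝ k G) y a := by
      filter_upwards [hs.mem_nhds hx] with y hy using (ih hy).symm
    rw [h2.fderiv_eq, fderiv_clm_apply hd (differentiableAt_const a)]
    simp

/-- A mean value estimate: a curve of smooth functions differentiates in all derivatives. -/
theorem hasDerivAt_iteratedFDeriv_slice {G : ℝ × E → F} {s : Set E} (hs : IsOpen s)
    (hG : ContDiffOn ℝ ∞ G (Set.univ ×ˢ s)) (k : ℕ) (t : ℝ) {y : E} (hy : y ∈ s) :
    HasDerivAt (fun t => iteratedFDeriv ℝ k (fun y => G (t, y)) y)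
      (iteratedFDeriv ℝ k (fun y => fderiv ℝ G (t, y) (1, 0)) y) t := by
  have hS : IsOpen (Set.univ ×ˢ s : Set (ℝ × E)) := isOpen_univ.prod hs
  have hz : (t, y) ∈ (Set.univ ×ˢ s : Set (ℝ × E)) := ⟨trivial, hy⟩
  have hG' : ContDiffOn ℝ ∞ (fun z => fderiv ℝ G z (1, 0)) (Set.univ ×ˢ s) :=
    (hG.fderiv_of_isOpen hS (m := ∞) (by norm_cast)).clm_apply contDiffOn_const
  rw [iteratedFDeriv_slice hs hG' k t hy, ← fderiv_iteratedFDeriv_apply hS hG k (1, 0) hz]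
  have h1 : (fun t => iteratedFDeriv ℝ k (fun y => G (t, y)) y) = fun t =>
      ContinuousMultilinearMap.compContinuousLinearMapL (F := F)
        (fun _ : Fin k => ContinuousLinearMap.inr ℝ ℝ E) (iteratedFDeriv ℝ k G (t, y)) := by
    ext1 t
    exact iteratedFDeriv_slice hs hG k t hy
  rw [h1]
  have h2 : HasFDerivAt (iteratedFDeriv ℝ k G) (fderiv ℝ (iteratedFDeriv ℝ k G) (t, y)) (t, y) :=
    (((hG.iteratedFDeriv_of_isOpen hS k).contDiffAt (hS.mem_nhds hz)).differentiableAt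
      (by simp)).hasFDerivAt
  have h3 : HasDerivAt (fun t : ℝ => (t, y)) ((1 : ℝ), (0 : E)) t :=
    (hasDerivAt_id t).prodMk (hasDerivAt_const t y)
  exact (ContinuousLinearMap.hasFDerivAt _).comp_hasDerivAt t (h2.comp_hasDerivAt t h3)

end Slice

/-! ### Convergence in `C^∞(P)` and smooth families of functions -/

section SmoothFnTopology

variable {d : ℕ} {P : Type u} [TopologicalSpace P] [ChartedSpace (EuclideanSpace ℝ (Fin d)) P]
  [IsManifold (𝓡 d) ∞ P]

theorem SmoothFn.contDiffOn (f : SmoothFn d P)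
    {e : OpenPartialHomeomorph P (EuclideanSpace ℝ (Fin d))}
    (he : e ∈ atlas (EuclideanSpace ℝ (Fin d)) P) : ContDiffOn ℝ ∞ (f ∘ e.symm) e.target :=
  fun _ hx => (f.contDiffAt he hx).contDiffWithinAt

theorem SmoothFn.iteratedFDeriv_sub_apply (f g : SmoothFn d P)
    {e : OpenPartialHomeomorph P (EuclideanSpace ℝ (Fin d))}
    (he : e ∈ atlas (EuclideanSpace ℝ (Fin d)) P) {x : EuclideanSpace ℝ (Fin d)}
    (hx : x ∈ e.target) (k : ℕ) :
    iteratedFDeriv ℝ k (⇑(f - g) ∘ e.symm) x =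
      iteratedFDeriv ℝ k (f ∘ e.symm) x - iteratedFDeriv ℝ k (g ∘ e.symm) x := by
  have hf := (f.contDiffAt he hx).of_le (m := k) (by exact_mod_cast le_top)
  have hg := (g.contDiffAt he hx).of_le (m := k) (by exact_mod_cast le_top)
  exact _root_.iteratedFDeriv_sub_apply hf hg

/-- Convergence in `C^∞(P)` is locally uniform convergence of all derivatives in charts. -/
theorem SmoothFn.tendsto_of_forall_chart {ι : Type*} {l : Filter ι} {F : ι → SmoothFn d P}
    {f : SmoothFn d P}
    (h : ∀ e ∈ atlas (EuclideanSpace ℝ (Fin d)) P, ∀ K ⊆ e.target, IsCompact K → ∀ k : ℕ,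
      ∀ ε > 0, ∀ᶠ a in l, ∀ x ∈ K, ‖iteratedFDeriv ℝ k (F a ∘ e.symm) x -
        iteratedFDeriv ℝ k (f ∘ e.symm) x‖ ≤ ε) :
    Filter.Tendsto F l (𝓝 f) := by
  refine (SmoothFn.withSeminorms.tendsto_nhds _ _).2 fun i ε hε => ?_
  filter_upwards [h i.chart i.chart_mem i.K i.subset_target i.isCompact i.order (ε / 2)
    (half_pos hε)] with a ha
  refine lt_of_le_of_lt (Real.iSup_le (fun x => ?_) (half_pos hε).le) (half_lt_self hε)
  rw [SmoothFn.iteratedFDeriv_sub_apply _ _ i.chart_mem (i.subset_target x.2)]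
  exact ha x x.2

theorem SmoothFn.eventually_of_tendsto {ι : Type*} {l : Filter ι} {F : ι → SmoothFn d P}
    {f : SmoothFn d P} (h : Filter.Tendsto F l (𝓝 f))
    {e : OpenPartialHomeomorph P (EuclideanSpace ℝ (Fin d))}
    (he : e ∈ atlas (EuclideanSpace ℝ (Fin d)) P) {K : Set (EuclideanSpace ℝ (Fin d))}
    (hKe : K ⊆ e.target) (hK : IsCompact K) (k : ℕ) {ε : ℝ} (hε : 0 < ε) :
    ∀ᶠ a in l, ∀ x ∈ K, ‖iteratedFDeriv ℝ k (F a ∘ e.symm) x -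
        iteratedFDeriv ℝ k (f ∘ e.symm) x‖ < ε := by
  filter_upwards [(SmoothFn.withSeminorms.tendsto_nhds _ _).1 h ⟨e, he, K, hK, hKe, k⟩ ε hε]
    with a ha x hx
  rw [← SmoothFn.iteratedFDeriv_sub_apply _ _ he (hKe hx)]
  exact (SmoothFn.le_chartSeminorm ⟨e, he, K, hK, hKe, k⟩ (F a - f) hx).trans_lt ha

theorem SmoothFn.tendsto_iteratedFDeriv {ι : Type*} {l : Filter ι} {F : ι → SmoothFn d P}
    {f : SmoothFn d P} (h : Filter.Tendsto F l (𝓝 f))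
    {e : OpenPartialHomeomorph P (EuclideanSpace ℝ (Fin d))}
    (he : e ∈ atlas (EuclideanSpace ℝ (Fin d)) P) {x : EuclideanSpace ℝ (Fin d)}
    (hx : x ∈ e.target) (k : ℕ) :
    Filter.Tendsto (fun a => iteratedFDeriv ℝ k (F a ∘ e.symm) x) l
      (𝓝 (iteratedFDeriv ℝ k (f ∘ e.symm) x)) := by
  rw [Metric.tendsto_nhds]
  intro ε hε
  filter_upwards [SmoothFn.eventually_of_tendsto h he (Set.singleton_subset_iff.2 hx)
    isCompact_singleton k hε] with a ha
  rw [dist_eq_norm]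
  exact ha x rfl

section Family

variable {W : Type*} [NormedAddCommGroup W] [NormedSpace ℝ W]

theorem contMDiffOn_prodMap_chart_symm {e : OpenPartialHomeomorph P (EuclideanSpace ℝ (Fin d))}
    (he : e ∈ atlas (EuclideanSpace ℝ (Fin d)) P) :
    ContMDiffOn 𝓘(ℝ, W × EuclideanSpace ℝ (Fin d)) (𝓘(ℝ, W).prod (𝓡 d)) ∞
      (fun z : W × EuclideanSpace ℝ (Fin d) => (z.1, e.symm z.2)) (Set.univ ×ˢ e.target) := by
  have h := contMDiffOn_symm_of_mem_maximalAtlas (I := 𝓡 d) (n := ∞)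
    (IsManifold.subset_maximalAtlas he)
  refine ContMDiffOn.prodMk contDiff_fst.contMDiff.contMDiffOn
    (h.comp contDiff_snd.contMDiff.contMDiffOn fun z hz => hz.2)

/-- A smooth function on `W × P` in a chart of `P`. -/
theorem ContMDiff.contDiffOn_chart {R : W × P → ℂ}
    (hR : ContMDiff (𝓘(ℝ, W).prod (𝓡 d)) 𝓘(ℝ, ℂ) ∞ R)
    {e : OpenPartialHomeomorph P (EuclideanSpace ℝ (Fin d))}
    (he : e ∈ atlas (EuclideanSpace ℝ (Fin d)) P) :
    ContDiffOn ℝ ∞ (fun z : W × EuclideanSpace ℝ (Fin d) => R (z.1, e.symm z.2))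
      (Set.univ ×ˢ e.target) :=
  (hR.comp_contMDiffOn (contMDiffOn_prodMap_chart_symm he)).contDiffOn

/-- Uniformity on compact sets of a continuous family of functions. -/
theorem IsCompact.eventually_norm_sub_le {X Y F : Type*} [TopologicalSpace X] [TopologicalSpace Y]
    [NormedAddCommGroup F] {m : X × Y → F} {s K : Set Y} (hs : IsOpen s)
    (hm : ContinuousOn m (Set.univ ×ˢ s)) (hK : IsCompact K) (hKs : K ⊆ s) (x₀ : X) {ε : ℝ}
    (hε : 0 < ε) : ∀ᶠ x in 𝓝 x₀, ∀ y ∈ K, ‖m (x, y) - m (x₀, y)‖ ≤ ε := by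
  refine hK.eventually_forall_of_forall_eventually
    (P := fun x y => ‖m (x, y) - m (x₀, y)‖ ≤ ε) fun y hy => ?_
  have h1 : ContinuousAt m (x₀, y) :=
    hm.continuousAt ((isOpen_univ.prod hs).mem_nhds ⟨trivial, hKs hy⟩)
  have h2 : ContinuousAt (fun z : X × Y => m (x₀, z.2)) (x₀, y) :=
    ContinuousAt.comp (f := fun z : X × Y => (x₀, z.2)) (by exact h1)
      (continuous_const.prodMk continuous_snd).continuousAt
  have h3 := (h1.sub h2).norm.tendsto
  simp only [Pi.sub_apply, sub_self, norm_zero] at h3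
  filter_upwards [h3.eventually (gt_mem_nhds hε)] with z hz
  exact le_of_lt hz

/-- The derivatives in the direction of `P` are jointly continuous in parameter and point, hence
vary uniformly on compact sets. -/
theorem SmoothFn.continuous_of_contMDiff {R : W × P → ℂ}
    (hR : ContMDiff (𝓘(ℝ, W).prod (𝓡 d)) 𝓘(ℝ, ℂ) ∞ R) {F : W → SmoothFn d P}
    (hF : ∀ w p, F w p = R (w, p)) : Continuous F := by
  refine continuous_iff_continuousAt.2 fun w₀ => SmoothFn.tendsto_of_forall_chart
    fun e he K hKe hK k ε hε => ?_
  have hm := continuousOn_iteratedFDeriv_slice e.open_target (hR.contDiffOn_chart he) k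
  have hFe : ∀ w, F w ∘ e.symm = fun y => R (w, e.symm y) := fun w => funext fun y => hF w _
  simp only [hFe]
  exact hK.eventually_norm_sub_le e.open_target hm hKe w₀ hε

/-- A smooth curve of smooth functions is differentiable as a curve in `C^∞(P)`. -/
theorem SmoothFn.tendsto_slope_of_contMDiff {R : ℝ × P → ℂ}
    (hR : ContMDiff (𝓘(ℝ, ℝ).prod (𝓡 d)) 𝓘(ℝ, ℂ) ∞ R) {F : ℝ → SmoothFn d P}
    (hF : ∀ t p, F t p = R (t, p)) {D : SmoothFn d P}
    (hD : ∀ p, HasDerivAt (fun t => R (t, p)) (D p) 0) :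
    Filter.Tendsto (fun t : ℝ => t⁻¹ • (F t - F 0)) (𝓝[≠] 0) (𝓝 D) := by
  refine SmoothFn.tendsto_of_forall_chart fun e he K hKe hK k ε hε => ?_
  have hG := hR.contDiffOn_chart he
  set G := fun z : ℝ × EuclideanSpace ℝ (Fin d) => R (z.1, e.symm z.2) with hGdef
  have hS : IsOpen (Set.univ ×ˢ e.target : Set (ℝ × EuclideanSpace ℝ (Fin d))) :=
    isOpen_univ.prod e.open_target
  have hG' : ContDiffOn ℝ ∞ (fun z => fderiv ℝ G z (1, 0)) (Set.univ ×ˢ e.target) :=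
    (hG.fderiv_of_isOpen hS (m := ∞) (by norm_cast)).clm_apply contDiffOn_const
  have hm := continuousOn_iteratedFDeriv_slice e.open_target hG' k
  have hFe : ∀ w, F w ∘ e.symm = fun y => G (w, y) := fun w => funext fun y => hF w _
  have hDe : ∀ y ∈ e.target, (D ∘ e.symm) y = fderiv ℝ G (0, y) (1, 0) := by
    intro y hy
    have h2 : HasFDerivAt G (fderiv ℝ G (0, y)) (0, y) :=
      ((hG.contDiffAt (hS.mem_nhds ⟨trivial, hy⟩)).differentiableAt (by simp)).hasFDerivAt
    have h3 : HasDerivAt (fun t : ℝ => (t, y)) ((1 : ℝ), (0 : EuclideanSpace ℝ (Fin d))) 0 :=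
      (hasDerivAt_id 0).prodMk (hasDerivAt_const 0 y)
    have h4 := HasFDerivAt.comp_hasDerivAt (l := G) 0 h2 h3
    exact (hD (e.symm y)).unique h4
  have hDk : ∀ y ∈ e.target, iteratedFDeriv ℝ k (D ∘ e.symm) y =
      iteratedFDeriv ℝ k (fun y => fderiv ℝ G (0, y) (1, 0)) y := by
    intro y hy
    refine (Filter.EventuallyEq.iteratedFDeriv ℝ ?_ k).eq_of_nhds
    filter_upwards [e.open_target.mem_nhds hy] with z hz using hDe z hz
  have hev := hK.eventually_norm_sub_le e.open_target hm hKe 0 hε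
  obtain ⟨δ, hδ, hball⟩ := Metric.eventually_nhds_iff_ball.1 hev
  filter_upwards [nhdsWithin_le_nhds (Metric.ball_mem_nhds (0 : ℝ) hδ), self_mem_nhdsWithin]
    with t ht ht0 y hy
  have hy' := hKe hy
  have h1 : iteratedFDeriv ℝ k (⇑(t⁻¹ • (F t - F 0)) ∘ e.symm) y =
      t⁻¹ • (iteratedFDeriv ℝ k (fun y => G (t, y)) y -
        iteratedFDeriv ℝ k (fun y => G (0, y)) y) := by
    rw [← hFe, ← hFe, ← SmoothFn.iteratedFDeriv_sub_apply _ _ he hy']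
    exact iteratedFDeriv_const_smul_apply (a := t⁻¹)
      (((F t - F 0).contDiffAt he hy').of_le (m := k) (by exact_mod_cast le_top))
  rw [h1, hDk y hy']
  set m := fun t => iteratedFDeriv ℝ k (fun y => fderiv ℝ G (t, y) (1, 0)) y with hmdef
  -- The mean value inequality is applied after subtracting the linear term `t • m 0`. The remaining
  -- derivative `m s - m 0` is at most `ε` on the ball, uniformly for `y ∈ K`.
  have h2 : ∀ s ∈ Metric.ball (0 : ℝ) δ, HasDerivWithinAt
      (fun t => iteratedFDeriv ℝ k (fun y => G (t, y)) y - t • m 0) (m s - m 0)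
      (Metric.ball (0 : ℝ) δ) s := by
    intro s _
    have := (hasDerivAt_iteratedFDeriv_slice e.open_target hG k s hy').sub
      ((hasDerivAt_id s).smul_const (m 0))
    rw [one_smul] at this
    exact this.hasDerivWithinAt
  have h3 := Convex.norm_image_sub_le_of_norm_hasDerivWithin_le h2
    (fun s hs => hball s hs y hy) (convex_ball 0 δ) (Metric.mem_ball_self hδ) ht
  rw [zero_smul, sub_zero, sub_zero] at h3
  have ht0' : t ≠ 0 := ht0
  have h4 : t⁻¹ • (iteratedFDeriv ℝ k (fun y => G (t, y)) y -
        iteratedFDeriv ℝ k (fun y => G (0, y)) y) - m 0 =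
      t⁻¹ • (iteratedFDeriv ℝ k (fun y => G (t, y)) y - t • m 0 -
        iteratedFDeriv ℝ k (fun y => G (0, y)) y) := by
    rw [sub_right_comm, smul_sub _ _ (t • m 0), smul_smul, inv_mul_cancel₀ ht0', one_smul]
  rw [h4, norm_smul, norm_inv]
  calc ‖t‖⁻¹ * _ ≤ ‖t‖⁻¹ * (ε * ‖t‖) := by gcongr
    _ = ε := by field_simp

/-- Derivatives in the parameter of smooth families are smooth. -/
theorem ContMDiff.contMDiff_deriv {R : ℝ × P → ℂ}
    (hR : ContMDiff (𝓘(ℝ, ℝ).prod (𝓡 d)) 𝓘(ℝ, ℂ) ∞ R) :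
    ContMDiff (𝓡 d) 𝓘(ℝ, ℂ) ∞ fun p => deriv (fun t => R (t, p)) 0 := by
  intro p
  have he := chart_mem_atlas (EuclideanSpace ℝ (Fin d)) p
  set e := chartAt (EuclideanSpace ℝ (Fin d)) p with hedef
  have hG := hR.contDiffOn_chart he
  set G := fun z : ℝ × EuclideanSpace ℝ (Fin d) => R (z.1, e.symm z.2) with hGdef
  have hS : IsOpen (Set.univ ×ˢ e.target : Set (ℝ × EuclideanSpace ℝ (Fin d))) :=
    isOpen_univ.prod e.open_target
  have hG' : ContDiffOn ℝ ∞ (fun z => fderiv ℝ G z (1, 0)) (Set.univ ×ˢ e.target) :=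
    (hG.fderiv_of_isOpen hS (m := ∞) (by norm_cast)).clm_apply contDiffOn_const
  have hG0 : ContDiffOn ℝ ∞ (fun y => fderiv ℝ G (0, y) (1, 0)) e.target :=
    hG'.comp (contDiff_const.prodMk contDiff_id).contDiffOn fun y hy => ⟨trivial, hy⟩
  have h1 : ContMDiffOn (𝓡 d) 𝓘(ℝ, ℂ) ∞ ((fun y => fderiv ℝ G (0, y) (1, 0)) ∘ e) e.source :=
    hG0.contMDiffOn.comp (contMDiffOn_of_mem_maximalAtlas (IsManifold.subset_maximalAtlas he))
      e.mapsTo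
  refine (h1.contMDiffAt (e.open_source.mem_nhds (mem_chart_source _ p))).congr_of_eventuallyEq ?_
  filter_upwards [e.open_source.mem_nhds (mem_chart_source _ p)] with q hq
  have h2 : HasFDerivAt G (fderiv ℝ G (0, e q)) (0, e q) :=
    ((hG.contDiffAt (hS.mem_nhds ⟨trivial, e.map_source hq⟩)).differentiableAt
      (by simp)).hasFDerivAt
  have h3 : HasDerivAt (fun t : ℝ => (t, e q)) ((1 : ℝ), (0 : EuclideanSpace ℝ (Fin d))) 0 :=
    (hasDerivAt_id 0).prodMk (hasDerivAt_const 0 _)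
  have h4 := (h2.comp_hasDerivAt 0 h3).deriv
  simp only [hGdef, Function.comp_def, e.left_inv hq] at h4
  exact h4

end Family

end SmoothFnTopology

/-! ### Pull-back along smooth families of self-maps: joint continuity and generators -/

section CompFamily

variable {d : ℕ} {P : Type u} [TopologicalSpace P] [ChartedSpace (EuclideanSpace ℝ (Fin d)) P]
  [IsManifold (𝓡 d) ∞ P] {W : Type*} [NormedAddCommGroup W] [NormedSpace ℝ W]

theorem SmoothFn.continuous_chartSeminorm (i : ChartIndex d P) :
    Continuous (SmoothFn.chartSeminorm i) :=
  SmoothFn.withSeminorms.continuous_seminorm i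

/-- Near a point, all derivatives up to order `k` of a smooth map have norm at most `D ^ i`. -/
theorem ContDiffOn.exists_eventually_norm_iteratedFDeriv_le {E F : Type*} [NormedAddCommGroup E]
    [NormedSpace ℝ E] [NormedAddCommGroup F] [NormedSpace ℝ F] {g : E → F} {s : Set E}
    (hs : IsOpen s) (hg : ContDiffOn ℝ ∞ g s) {x : E} (hx : x ∈ s) (k : ℕ) :
    ∃ D : ℝ, 0 ≤ D ∧ ∀ᶠ y in 𝓝 x, ∀ i, 1 ≤ i → i ≤ k → ‖iteratedFDeriv ℝ i g y‖ ≤ D ^ i := by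
  set c : ℕ → ℝ := fun i => ‖iteratedFDeriv ℝ i g x‖ + 1 with hc
  have hc0 : ∀ i, 0 ≤ c i := fun i => by positivity
  -- `D` is at least 1 and dominates every `c i`, so `c i ≤ D ≤ D ^ i` for `i ≥ 1`. The powers `D ^
  -- i` are the form required by `norm_iteratedFDerivWithin_comp_le`.
  set D := 1 + ∑ i ∈ Finset.range (k + 1), c i with hD
  have hD1 : 1 ≤ D := le_add_of_nonneg_right (Finset.sum_nonneg fun i _ => hc0 i)
  refine ⟨D, zero_le_one.trans hD1, ?_⟩
  have hev : ∀ᶠ y in 𝓝 x, ∀ i ∈ Finset.range (k + 1), ‖iteratedFDeriv ℝ i g y‖ < c i := by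
    refine (Filter.eventually_all_finset _).2 fun i _ => ?_
    have h1 := ((hg.iteratedFDeriv_of_isOpen hs i).continuousOn.continuousAt
      (hs.mem_nhds hx)).norm
    exact h1.tendsto.eventually (gt_mem_nhds (lt_add_one _))
  filter_upwards [hev] with y hy i hi1 hik
  have hi : i ∈ Finset.range (k + 1) := Finset.mem_range.2 (Nat.lt_succ_of_le hik)
  calc ‖iteratedFDeriv ℝ i g y‖ ≤ c i := (hy i hi).le
    _ ≤ ∑ i ∈ Finset.range (k + 1), c i := Finset.single_le_sum (fun i _ => hc0 i) hi
    _ ≤ D := le_add_of_nonneg_left zero_le_one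
    _ = D ^ 1 := (pow_one D).symm
    _ ≤ D ^ i := pow_le_pow_right₀ hD1 hi1

/-- Local bounds of the derivatives of `f ∘ S` by a continuous seminorm of `f`. -/
theorem SmoothFn.exists_bound_comp {S : W × P → P}
    (hS : ContMDiff (𝓘(ℝ, W).prod (𝓡 d)) (𝓡 d) ∞ S)
    {e : OpenPartialHomeomorph P (EuclideanSpace ℝ (Fin d))}
    (he : e ∈ atlas (EuclideanSpace ℝ (Fin d)) P) (k : ℕ) (w₀ : W)
    {y₀ : EuclideanSpace ℝ (Fin d)} (hy₀ : y₀ ∈ e.target) :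
    ∃ q : SmoothFn d P → ℝ, Continuous q ∧ q 0 = 0 ∧ (∀ f, 0 ≤ q f) ∧
      ∀ᶠ z in 𝓝 (w₀, y₀), ∀ f : SmoothFn d P,
        ‖iteratedFDeriv ℝ k (fun z : W × EuclideanSpace ℝ (Fin d) => f (S (z.1, e.symm z.2))) z‖
          ≤ q f := by
  set T := fun z : W × EuclideanSpace ℝ (Fin d) => S (z.1, e.symm z.2) with hT
  have hTs : ContMDiffOn 𝓘(ℝ, W × EuclideanSpace ℝ (Fin d)) (𝓡 d) ∞ T
    (Set.univ ×ˢ e.target) := hS.comp_contMDiffOn (contMDiffOn_prodMap_chart_symm he)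
  have he' := chart_mem_atlas (EuclideanSpace ℝ (Fin d)) (T (w₀, y₀))
  set e' := chartAt (EuclideanSpace ℝ (Fin d)) (T (w₀, y₀)) with he'def
  have hO : IsOpen (Set.univ ×ˢ e.target : Set (W × EuclideanSpace ℝ (Fin d))) :=
    isOpen_univ.prod e.open_target
  obtain ⟨r, hr, hball⟩ := Metric.nhds_basis_closedBall.mem_iff.1
    (e'.open_target.mem_nhds (e'.map_source (mem_chart_source _ (T (w₀, y₀)))))
  set K := Metric.closedBall (e' (T (w₀, y₀))) r with hK
  have hO1 : IsOpen ((Set.univ ×ˢ e.target) ∩ T ⁻¹' e'.source) :=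
    hTs.continuousOn.isOpen_inter_preimage hO e'.open_source
  set s := (Set.univ ×ˢ e.target) ∩ T ⁻¹' e'.source with hs
  have hg : ContDiffOn ℝ ∞ (fun z => e' (T z)) s :=
    ((contMDiffOn_of_mem_maximalAtlas (I := 𝓡 d) (n := ∞)
      (IsManifold.subset_maximalAtlas he')).comp (hTs.mono Set.inter_subset_left)
      fun z hz => hz.2).contDiffOn
  have hz₀ : (w₀, y₀) ∈ s := ⟨⟨trivial, hy₀⟩, mem_chart_source _ (T (w₀, y₀))⟩
  obtain ⟨D, hD0, hD⟩ := hg.exists_eventually_norm_iteratedFDeriv_le hO1 hz₀ k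
  have hKc : IsCompact K := isCompact_closedBall _ _
  let idx : ℕ → ChartIndex d P := fun j => ⟨e', he', K, hKc, hball, j⟩
  -- The bound for the `k`-th derivative of a composition: the outer function `f ∘ e'.symm` is
  -- controlled by the seminorms of order `j ≤ k` on the closed ball `K`, the inner one by powers of
  -- `D`.
  refine ⟨fun f => k.factorial * (∑ j ∈ Finset.range (k + 1),
    SmoothFn.chartSeminorm (idx j) f) * D ^ k, ?_, ?_, ?_, ?_⟩
  · exact (continuous_const.mul (continuous_finsetSum _ fun j _ =>
      SmoothFn.continuous_chartSeminorm _)).mul continuous_const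
  · simp
  · intro f
    have : ∀ j, 0 ≤ SmoothFn.chartSeminorm (idx j) f := fun j => apply_nonneg _ _
    have := Finset.sum_nonneg fun j (_ : j ∈ Finset.range (k + 1)) => this j
    positivity
  · have hgK : ∀ᶠ z in 𝓝 (w₀, y₀), e' (T z) ∈ K :=
      (hg.continuousOn.continuousAt (hO1.mem_nhds hz₀)).eventually
        (Metric.closedBall_mem_nhds _ hr)
    filter_upwards [hD, hgK, hO1.mem_nhds hz₀] with z hDz hzK hzs f
    have h1 : iteratedFDeriv ℝ k (fun z => f (T z)) z =
        iteratedFDeriv ℝ k ((f ∘ e'.symm) ∘ fun z => e' (T z)) z := by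
      refine (Filter.EventuallyEq.iteratedFDeriv ℝ ?_ k).eq_of_nhds
      filter_upwards [hO1.mem_nhds hzs] with x hx
      simp only [Function.comp_apply, e'.left_inv hx.2]
    change ‖iteratedFDeriv ℝ k (fun z => f (T z)) z‖ ≤ _
    rw [h1, ← iteratedFDerivWithin_of_isOpen k hO1 hzs]
    refine norm_iteratedFDerivWithin_comp_le (f.contDiffOn he') hg (by exact_mod_cast le_top)
      e'.open_target.uniqueDiffOn hO1.uniqueDiffOn (fun x hx => e'.map_source hx.2) hzs ?_ ?_
    · intro i hi
      rw [iteratedFDerivWithin_of_isOpen i e'.open_target (e'.map_source hzs.2)]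
      refine (SmoothFn.le_chartSeminorm (idx i) f hzK).trans ?_
      exact Finset.single_le_sum (f := fun j => SmoothFn.chartSeminorm (idx j) f)
        (fun j _ => apply_nonneg _ _) (Finset.mem_range.2 (Nat.lt_succ_of_le hi))
    · intro i hi1 hik
      rw [iteratedFDerivWithin_of_isOpen i hO1 hzs]
      exact hDz i hi1 hik

/-- Local bounds add up over a finite cover of `K`. The derivatives are taken jointly in parameter
and point, so that order `k` serves the pull-backs and order `k + 1` their generators. -/
theorem SmoothFn.exists_bound_comp_compact {S : W × P → P}
    (hS : ContMDiff (𝓘(ℝ, W).prod (𝓡 d)) (𝓡 d) ∞ S)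
    {e : OpenPartialHomeomorph P (EuclideanSpace ℝ (Fin d))}
    (he : e ∈ atlas (EuclideanSpace ℝ (Fin d)) P) (k : ℕ) (w₀ : W)
    {K : Set (EuclideanSpace ℝ (Fin d))} (hKe : K ⊆ e.target) (hK : IsCompact K) :
    ∃ q : SmoothFn d P → ℝ, Continuous q ∧ q 0 = 0 ∧ (∀ f, 0 ≤ q f) ∧
      ∀ᶠ w in 𝓝 w₀, ∀ y ∈ K, ∀ f : SmoothFn d P,
        ‖iteratedFDeriv ℝ k (fun z : W × EuclideanSpace ℝ (Fin d) => f (S (z.1, e.symm z.2)))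
          (w, y)‖ ≤ q f := by
  refine hK.induction_on (p := fun L => ∃ q : SmoothFn d P → ℝ, Continuous q ∧ q 0 = 0 ∧
      (∀ f, 0 ≤ q f) ∧ ∀ᶠ w in 𝓝 w₀, ∀ y ∈ L, ∀ f : SmoothFn d P,
        ‖iteratedFDeriv ℝ k (fun z : W × EuclideanSpace ℝ (Fin d) => f (S (z.1, e.symm z.2)))
          (w, y)‖ ≤ q f) ?_ ?_ ?_ ?_
  · exact ⟨0, continuous_zero, rfl, fun _ => le_rfl, Filter.Eventually.of_forall fun _ _ h => h.elim⟩
  · rintro s t hst ⟨q, h1, h2, h3, h4⟩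
    exact ⟨q, h1, h2, h3, h4.mono fun w hw y hy => hw y (hst hy)⟩
  · rintro s t ⟨q, h1, h2, h3, h4⟩ ⟨q', h1', h2', h3', h4'⟩
    refine ⟨q + q', h1.add h1', by simp [h2, h2'], fun f => add_nonneg (h3 f) (h3' f), ?_⟩
    filter_upwards [h4, h4'] with w hw hw' y hy f
    rcases hy with hy | hy
    · exact (hw y hy f).trans (le_add_of_nonneg_right (h3' f))
    · exact (hw' y hy f).trans (le_add_of_nonneg_left (h3 f))
  · intro y hy
    obtain ⟨q, h1, h2, h3, h4⟩ := SmoothFn.exists_bound_comp hS he k w₀ (hKe hy)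
    obtain ⟨U, hU, V, hV, hUV⟩ := mem_nhds_prod_iff.1 h4
    refine ⟨V, nhdsWithin_le_nhds hV, q, h1, h2, h3, ?_⟩
    filter_upwards [hU] with w hw y hy
    exact hUV (Set.mk_mem_prod hw hy)

theorem ContMDiff.contDiff_param {R : W × P → ℂ}
    (hR : ContMDiff (𝓘(ℝ, W).prod (𝓡 d)) 𝓘(ℝ, ℂ) ∞ R) (p : P) :
    ContDiff ℝ ∞ fun w => R (w, p) :=
  (hR.comp (contMDiff_id.prodMk contMDiff_const)).contDiff

/-- Pull-back of smooth functions along the members of a smooth family of self-maps. -/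
def SmoothFn.compFamily {S : W × P → P} (hS : ContMDiff (𝓘(ℝ, W).prod (𝓡 d)) (𝓡 d) ∞ S)
    (w : W) : SmoothFn d P →ₗ[ℝ] SmoothFn d P where
  toFun f := ⟨fun p => f (S (w, p)),
    f.contMDiff.comp (hS.comp (contMDiff_const.prodMk contMDiff_id))⟩
  map_add' _ _ := rfl
  map_smul' _ _ := rfl

/-- With `β w f = f ∘ S(w, ·)`, one has `β w f - β w₀ f₀ = β w (f - f₀) + (β w f₀ - β w₀ f₀)`. The
first term is small by a bound that is uniform for `w` near `w₀`, the second because `f₀ ∘ S` is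
smooth. -/
theorem SmoothFn.continuous_compFamily {S : W × P → P}
    (hS : ContMDiff (𝓘(ℝ, W).prod (𝓡 d)) (𝓡 d) ∞ S) :
    Continuous fun z : W × SmoothFn d P => SmoothFn.compFamily hS z.1 z.2 := by
  refine continuous_iff_continuousAt.2 fun ⟨w₀, f₀⟩ => SmoothFn.tendsto_of_forall_chart
    fun e he K hKe hK k ε hε => ?_
  obtain ⟨q, hqc, hq0, -, hq⟩ := SmoothFn.exists_bound_comp_compact hS he k w₀ hKe hK
  have h1 : Filter.Tendsto (fun w => SmoothFn.compFamily hS w f₀) (𝓝 w₀)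
      (𝓝 (SmoothFn.compFamily hS w₀ f₀)) :=
    (SmoothFn.continuous_of_contMDiff (f₀.contMDiff.comp hS) fun _ _ => rfl).tendsto w₀
  have h2 := SmoothFn.eventually_of_tendsto h1 he hKe hK k (half_pos hε)
  have h3 : Filter.Tendsto (fun z : W × SmoothFn d P => q (z.2 - f₀)) (𝓝 (w₀, f₀)) (𝓝 0) := by
    have : Continuous fun z : W × SmoothFn d P => q (z.2 - f₀) :=
      hqc.comp (continuous_snd.sub continuous_const)
    exact this.tendsto' _ _ (by simp [hq0])
  filter_upwards [h3.eventually (gt_mem_nhds (half_pos hε)),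
    (continuous_fst.tendsto (w₀, f₀)).eventually hq,
    (continuous_fst.tendsto (w₀, f₀)).eventually h2] with ⟨w, f⟩ hz1 hz2 hz3 y hy
  have h4 : iteratedFDeriv ℝ k (SmoothFn.compFamily hS w (f - f₀) ∘ e.symm) y =
      iteratedFDeriv ℝ k (SmoothFn.compFamily hS w f ∘ e.symm) y -
        iteratedFDeriv ℝ k (SmoothFn.compFamily hS w f₀ ∘ e.symm) y := by
    rw [map_sub, SmoothFn.iteratedFDeriv_sub_apply _ _ he (hKe hy)]
  have h5 : ‖iteratedFDeriv ℝ k (SmoothFn.compFamily hS w (f - f₀) ∘ e.symm) y‖ ≤ q (f - f₀) :=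
    (norm_iteratedFDeriv_slice_le e.open_target
      (((f - f₀).contMDiff.comp hS).contDiffOn_chart he) k w (hKe hy)).trans (hz2 y hy _)
  have h6 := norm_add_le (iteratedFDeriv ℝ k (SmoothFn.compFamily hS w (f - f₀) ∘ e.symm) y)
    (iteratedFDeriv ℝ k (SmoothFn.compFamily hS w f₀ ∘ e.symm) y -
      iteratedFDeriv ℝ k (SmoothFn.compFamily hS w₀ f₀ ∘ e.symm) y)
  rw [h4, sub_add_sub_cancel, ← h4] at h6
  refine h6.trans ?_
  have := hz3 y hy
  dsimp only at hz1
  linarith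

/-- The derivative `f ↦ ∂_t f(S(t, ·))` at `t = 0` along a smooth curve of self-maps. -/
def SmoothFn.generator {S : ℝ × P → P} (hS : ContMDiff (𝓘(ℝ, ℝ).prod (𝓡 d)) (𝓡 d) ∞ S) :
    SmoothFn d P →ₗ[ℝ] SmoothFn d P where
  toFun f := ⟨fun p => deriv (fun t => f (S (t, p))) 0, (f.contMDiff.comp hS).contMDiff_deriv⟩
  map_add' f g := by
    ext p
    have hf := ((f.contMDiff.comp hS).contDiff_param p).differentiable (by simp) 0
    have hg := ((g.contMDiff.comp hS).contDiff_param p).differentiable (by simp) 0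
    exact deriv_add hf hg
  map_smul' c f := by
    ext p
    exact deriv_const_smul_field c _

theorem SmoothFn.hasDerivAt_generator {S : ℝ × P → P}
    (hS : ContMDiff (𝓘(ℝ, ℝ).prod (𝓡 d)) (𝓡 d) ∞ S) (f : SmoothFn d P) (p : P) :
    HasDerivAt (fun t => f (S (t, p))) (SmoothFn.generator hS f p) 0 :=
  (((f.contMDiff.comp hS).contDiff_param p).differentiable (by simp) 0).hasDerivAt

/-- A `k`-th derivative of `∂_t (f ∘ S)` along `P` is a component of the joint derivative of `f ∘ S`
of order `k + 1`, and the latter is bounded by a continuous function of `f` that vanishes at 0.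
Linearity transfers the bound to differences. -/
theorem SmoothFn.continuous_generator {S : ℝ × P → P}
    (hS : ContMDiff (𝓘(ℝ, ℝ).prod (𝓡 d)) (𝓡 d) ∞ S) : Continuous (SmoothFn.generator hS) := by
  refine continuous_iff_continuousAt.2 fun f₀ => SmoothFn.tendsto_of_forall_chart
    fun e he K hKe hK k ε hε => ?_
  obtain ⟨q, hqc, hq0, -, hq⟩ := SmoothFn.exists_bound_comp_compact hS he (k + 1) 0 hKe hK
  have h3 : Filter.Tendsto (fun f : SmoothFn d P => q (f - f₀)) (𝓝 f₀) (𝓝 0) :=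
    (hqc.comp (continuous_id.sub continuous_const)).tendsto' _ _ (by simp [hq0])
  filter_upwards [h3.eventually (gt_mem_nhds hε)] with f hf y hy
  have hyt := hKe hy
  rw [← SmoothFn.iteratedFDeriv_sub_apply _ _ he hyt, ← map_sub]
  refine le_trans ?_ hf.le
  refine le_trans ?_ (hq.self_of_nhds y hy (f - f₀))
  set g := f - f₀
  have hG := (g.contMDiff.comp hS).contDiffOn_chart he
  have hO : IsOpen (Set.univ ×ˢ e.target : Set (ℝ × EuclideanSpace ℝ (Fin d))) :=
    isOpen_univ.prod e.open_target
  change _ ≤ ‖iteratedFDeriv ℝ (k + 1) (fun z : ℝ × EuclideanSpace ℝ (Fin d) =>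
    (g ∘ S) (z.1, e.symm z.2)) (0, y)‖
  set G := fun z : ℝ × EuclideanSpace ℝ (Fin d) => (g ∘ S) (z.1, e.symm z.2) with hGdef
  have hG' : ContDiffOn ℝ ∞ (fun z => fderiv ℝ G z (1, 0)) (Set.univ ×ˢ e.target) :=
    (hG.fderiv_of_isOpen hO (m := ∞) (by norm_cast)).clm_apply contDiffOn_const
  have h1 : iteratedFDeriv ℝ k (SmoothFn.generator hS g ∘ e.symm) y =
      iteratedFDeriv ℝ k (fun y => fderiv ℝ G (0, y) (1, 0)) y := by
    refine (Filter.EventuallyEq.iteratedFDeriv ℝ ?_ k).eq_of_nhds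
    filter_upwards [e.open_target.mem_nhds hyt] with x hx
    have h2 : HasFDerivAt G (fderiv ℝ G (0, x)) (0, x) :=
      ((hG.contDiffAt (hO.mem_nhds ⟨trivial, hx⟩)).differentiableAt (by simp)).hasFDerivAt
    have h3 : HasDerivAt (fun t : ℝ => (t, x)) ((1 : ℝ), (0 : EuclideanSpace ℝ (Fin d))) 0 :=
      (hasDerivAt_id 0).prodMk (hasDerivAt_const 0 x)
    have h4 := HasFDerivAt.comp_hasDerivAt (l := G) 0 h2 h3
    exact (SmoothFn.hasDerivAt_generator hS g (e.symm x)).unique h4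
  rw [h1]
  refine (norm_iteratedFDeriv_slice_le e.open_target hG' k 0 hyt).trans ?_
  rw [← fderiv_iteratedFDeriv_apply hO hG k (1, 0) ⟨trivial, hyt⟩, ← norm_fderiv_iteratedFDeriv]
  refine (ContinuousLinearMap.le_opNorm _ _).trans (mul_le_of_le_one_right (norm_nonneg _) ?_)
  simp [Prod.norm_def]

end CompFamily

/-! ### Sums of `C^k`-maps between topological vector spaces -/

section LocallyConvexCalculus

variable {E : Type u} [AddCommGroup E] [Module ℝ E] [TopologicalSpace E]
  {F : Type v} [AddCommGroup F] [Module ℝ F] [TopologicalSpace F]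

theorem LCContDiffOn.continuousOn {k : ℕ} {f : E → F} {U : Set E} (hf : LCContDiffOn k f U) :
    ContinuousOn f U := by
  cases k with
  | zero => exact hf
  | succ k => exact hf.1

theorem LCContDiffOn.zero {k : ℕ} {U : Set E} : LCContDiffOn k (fun _ : E => (0 : F)) U := by
  induction k generalizing E with
  | zero => exact continuousOn_const
  | succ k ih =>
    exact ⟨continuousOn_const, fun _ => 0, fun x _ h => by
      simpa using tendsto_const_nhds, ih⟩

theorem LCContDiffOn.add [IsTopologicalAddGroup F] [ContinuousSMul ℝ F] {k : ℕ} {f g : E → F}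
    {U : Set E} (hf : LCContDiffOn k f U) (hg : LCContDiffOn k g U) :
    LCContDiffOn k (fun x => f x + g x) U := by
  induction k generalizing E with
  | zero => exact ContinuousOn.add hf hg
  | succ k ih =>
    obtain ⟨hfc, df, hdf, hdfk⟩ := hf
    obtain ⟨hgc, dg, hdg, hdgk⟩ := hg
    refine ⟨hfc.add hgc, fun x => df x + dg x, fun x hx h => ?_, ih hdfk hdgk⟩
    refine ((hdf x hx h).add (hdg x hx h)).congr fun t => ?_
    rw [← smul_add]
    congr 1
    exact (add_sub_add_comm _ _ _ _).symm

theorem LCContDiffOn.sum [IsTopologicalAddGroup F] [ContinuousSMul ℝ F] {k : ℕ} {ι : Type*}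
    (s : Finset ι) {f : ι → E → F} {U : Set E} (hf : ∀ i, LCContDiffOn k (f i) U) :
    LCContDiffOn k (fun x => ∑ i ∈ s, f i x) U := by
  classical
  induction s using Finset.induction_on with
  | empty => simpa using LCContDiffOn.zero
  | insert i s hi ih =>
    simp only [Finset.sum_insert hi]
    exact (hf i).add ih

end LocallyConvexCalculus

/-! ### Smoothness of a linear `ℝⁿ`-action from continuous generators -/

section Flow

variable {n : ℕ} {A : Type v} [AddCommGroup A] [Module ℝ A] [TopologicalSpace A]
  [IsTopologicalAddGroup A] [ContinuousSMul ℝ A]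

/-- Smoothness of a linear `ℝⁿ`-action on a locally convex space with continuous generators. -/
theorem lcContDiffOn_of_generators {β : (Fin n → ℝ) → A →ₗ[ℝ] A}
    (hβ : Continuous fun z : (Fin n → ℝ) × A => β z.1 z.2) {X : Fin n → A →L[ℝ] A}
    (hX : ∀ s : ℝ → Fin n → ℝ, ContDiff ℝ ∞ s → ∀ a,
      Filter.Tendsto (fun t : ℝ => t⁻¹ • (β (s t) a - β (s 0) a)) (𝓝[≠] 0)
        (𝓝 (∑ i, deriv s 0 i • β (s 0) (X i a))))
    (k : ℕ) {Y : Type v} [AddCommGroup Y] [Module ℝ Y] [TopologicalSpace Y]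
    {W : Type*} [NormedAddCommGroup W] [NormedSpace ℝ W] (l : Y →L[ℝ] W) {b : W → ℝ}
    (hb : ContDiff ℝ ∞ b) {T : W → Fin n → ℝ} (hT : ContDiff ℝ ∞ T) (v : Y →L[ℝ] A) :
    LCContDiffOn k (fun y => b (l y) • β (T (l y)) (v y)) Set.univ := by
  have hcont : ∀ {Y : Type v} [AddCommGroup Y] [Module ℝ Y] [TopologicalSpace Y] {W : Type _}
      [NormedAddCommGroup W] [NormedSpace ℝ W] (l : Y →L[ℝ] W) {b : W → ℝ}
      (_ : ContDiff ℝ ∞ b) {T : W → Fin n → ℝ} (_ : ContDiff ℝ ∞ T) (v : Y →L[ℝ] A),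
      Continuous (fun y => b (l y) • β (T (l y)) (v y)) := fun l _ hb _ hT v =>
    (hb.continuous.comp l.continuous).smul
      (hβ.comp ((hT.continuous.comp l.continuous).prodMk v.continuous))
  induction k generalizing Y W with
  | zero => exact (hcont l hb hT v).continuousOn
  | succ k ih =>
    -- The product rule, differentiating `b`, then `T` (which produces the generators), then `v`.
    -- Each term has the original form over `Y × Y` and `W × W`, with new coefficient and with `v ∘
    -- fst`, `X i ∘ v ∘ fst` or `v ∘ snd` in place of `v`. This is why the statement carries `b`,
    -- `T`, `l` and `v` as variables.
    refine ⟨(hcont l hb hT v).continuousOn, fun z =>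
      (fderiv ℝ b (l z.1) (l z.2) • β (T (l z.1)) (v z.1) +
        ∑ i, (b (l z.1) * fderiv ℝ T (l z.1) (l z.2) i) • β (T (l z.1)) (X i (v z.1))) +
        b (l z.1) • β (T (l z.1)) (v z.2), fun y _ h => ?_, ?_⟩
    · set w := l y
      set w' := l h
      have hline : ContDiff ℝ ∞ fun t : ℝ => w + t • w' :=
        contDiff_const.add (contDiff_id.smul contDiff_const)
      have hline' : HasDerivAt (fun t : ℝ => w + t • w') w' 0 := by
        simpa using ((hasDerivAt_id (0 : ℝ)).smul_const w').const_add w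
      have hb' : HasDerivAt (fun t : ℝ => b (w + t • w')) (fderiv ℝ b w w') 0 := by
        have h0 : HasFDerivAt b (fderiv ℝ b w) (w + (0 : ℝ) • w') := by
          simpa using (hb.differentiable (by simp) w).hasFDerivAt
        exact h0.comp_hasDerivAt (0 : ℝ) hline'
      have hT' : HasDerivAt (fun t : ℝ => T (w + t • w')) (fderiv ℝ T w w') 0 := by
        have h0 : HasFDerivAt T (fderiv ℝ T w) (w + (0 : ℝ) • w') := by
          simpa using (hT.differentiable (by simp) w).hasFDerivAt
        exact h0.comp_hasDerivAt (0 : ℝ) hline'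
      have h1 := hX (fun t => T (w + t • w')) (hT.comp hline) (v y)
      rw [hT'.deriv] at h1
      simp only [zero_smul, add_zero] at h1
      have h2 : ∀ a, Filter.Tendsto (fun t : ℝ => β (T (w + t • w')) a) (𝓝[≠] 0)
          (𝓝 (β (T w) a)) := fun a => by
        have hc : Continuous fun t : ℝ => β (T (w + t • w')) a :=
          hβ.comp ((hT.comp hline).continuous.prodMk continuous_const)
        exact (hc.tendsto' 0 _ (by simp)).mono_left nhdsWithin_le_nhds
      have h3 : Filter.Tendsto (fun t : ℝ => b (w + t • w')) (𝓝[≠] 0) (𝓝 (b w)) :=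
        ((hb.comp hline).continuous.tendsto' 0 _ (by simp)).mono_left nhdsWithin_le_nhds
      have h4 := hasDerivAt_iff_tendsto_slope_zero.1 hb'
      simp only [zero_add, zero_smul, add_zero, smul_eq_mul] at h4
      have h5 := ((h4.smul (h2 (v y))).add (h1.const_smul (b w))).add (h3.smul (h2 (v h)))
      have h6 : b w • ∑ i, fderiv ℝ T w w' i • β (T w) (X i (v y)) =
          ∑ i, (b w * fderiv ℝ T w w' i) • β (T w) (X i (v y)) := by
        rw [Finset.smul_sum]
        exact Finset.sum_congr rfl fun i _ => smul_smul _ _ _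
      rw [h6] at h5
      refine h5.congr' ?_
      filter_upwards [self_mem_nhdsWithin] with t ht
      have ht' : t ≠ 0 := ht
      have h7 : ∀ a : A, a = t⁻¹ • t • a := fun a => by
        rw [smul_smul, inv_mul_cancel₀ ht', one_smul]
      simp only [map_add, map_smul]
      change _ = t⁻¹ • (b (w + t • w') • (β (T (w + t • w')) (v y) +
        t • β (T (w + t • w')) (v h)) - b w • β (T w) (v y))
      set B := b (w + t • w')
      set p := β (T (w + t • w')) (v y)
      set r := β (T (w + t • w')) (v h)
      set p₀ := β (T w) (v y)
      match_scalars <;> field_simp <;> ring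
    · have hfst : ContDiff ℝ ∞ (Prod.fst : W × W → W) := contDiff_fst
      have hdb : ContDiff ℝ ∞ fun z : W × W => fderiv ℝ b z.1 z.2 :=
        ((hb.fderiv_right (m := ∞) (by norm_cast)).comp contDiff_fst).clm_apply contDiff_snd
      have hdT : ContDiff ℝ ∞ fun z : W × W => fderiv ℝ T z.1 z.2 :=
        ((hT.fderiv_right (m := ∞) (by norm_cast)).comp contDiff_fst).clm_apply contDiff_snd
      refine LCContDiffOn.add (LCContDiffOn.add ?_ (LCContDiffOn.sum _ fun i => ?_)) ?_
      all_goals rw [Set.univ_prod_univ]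
      · exact ih (l.prodMap l) hdb (hT.comp hfst) (v.comp (ContinuousLinearMap.fst ℝ Y Y))
      · exact ih (l.prodMap l) ((hb.comp hfst).mul (contDiff_pi.1 hdT i)) (hT.comp hfst)
          ((X i).comp (v.comp (ContinuousLinearMap.fst ℝ Y Y)))
      · exact ih (l.prodMap l) (hb.comp hfst) (hT.comp hfst)
          (v.comp (ContinuousLinearMap.snd ℝ Y Y))

end Flow

/-! ### Angles, exponential map and characters of the torus -/

section TorusCharts

theorem Circle.contMDiff_coe : ContMDiff (𝓡 1) 𝓘(ℝ, ℂ) ∞ (fun z : Circle => (z : ℂ)) :=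
  haveI : Fact (Module.finrank ℝ ℂ = 1 + 1) := Complex.finrank_real_complex_fact
  contMDiff_coe_sphere

theorem Circle.chartAt_target (g : Circle) :
    (chartAt (EuclideanSpace ℝ (Fin 1)) g).target = Set.univ :=
  haveI : Fact (Module.finrank ℝ ℂ = 1 + 1) := Complex.finrank_real_complex_fact
  stereographic'_target (E := ℂ) (n := 1) (-g : Metric.sphere (0 : ℂ) 1)

theorem Circle.chartAt_source (g : Circle) :
    (chartAt (EuclideanSpace ℝ (Fin 1)) g).source = {-g}ᶜ :=
  haveI : Fact (Module.finrank ℝ ℂ = 1 + 1) := Complex.finrank_real_complex_fact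
  stereographic'_source (E := ℂ) (n := 1) (-g : Metric.sphere (0 : ℂ) 1)

theorem Complex.contDiffAt_arg {z : ℂ} (hz : z ∈ Complex.slitPlane) :
    ContDiffAt ℝ ∞ Complex.arg z := by
  have h : ContDiffAt ℝ ∞ Complex.log z := (Complex.contDiffAt_log hz).restrict_scalars ℝ
  exact (Complex.imCLM.contDiff.contDiffAt.comp z h).congr_of_eventuallyEq
    (Filter.Eventually.of_forall fun w => (Complex.log_im w).symm)

/-- The charts of the circle lift to smooth angle functions. -/
theorem Circle.exists_lift_chart_symm (g : Circle) :
    ∃ θ : EuclideanSpace ℝ (Fin 1) → ℝ, ContDiff ℝ ∞ θ ∧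
      ∀ x, (chartAt (EuclideanSpace ℝ (Fin 1)) g).symm x = g * Circle.exp (θ x) := by
  set c := (chartAt (EuclideanSpace ℝ (Fin 1)) g).symm with hc
  have hcs : ContMDiff (𝓡 1) (𝓡 1) ∞ c := by
    rw [← contMDiffOn_univ, ← Circle.chartAt_target g]
    exact contMDiffOn_chart_symm
  have hsmooth : ContDiff ℝ ∞ fun x => ((g⁻¹ * c x : Circle) : ℂ) :=
    (Circle.contMDiff_coe.comp ((contMDiff_const (c := g⁻¹)).mul hcs)).contDiff
  -- The chart at `g` is stereographic projection from `-g`. Hence `g⁻¹ * c x` avoids `-1`, and its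
  -- argument is a smooth angle on the whole model space.
  have hslit : ∀ x, ((g⁻¹ * c x : Circle) : ℂ) ∈ Complex.slitPlane := by
    intro x
    have hx : c x ∈ ({-g}ᶜ : Set Circle) := by
      rw [← Circle.chartAt_source]
      exact OpenPartialHomeomorph.map_target _ (by rw [Circle.chartAt_target]; trivial)
    rw [Complex.mem_slitPlane_iff_arg]
    refine ⟨fun h => hx ?_, Circle.coe_ne_zero _⟩
    have h1 : g⁻¹ * c x = -1 := by
      rw [← Circle.arg_eq_arg, h, Circle.coe_neg, Circle.coe_one, Complex.arg_neg_one]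
    rw [Set.mem_singleton_iff, ← mul_inv_cancel_left g (c x), h1, mul_neg, mul_one]
  refine ⟨fun x => Complex.arg (g⁻¹ * c x : Circle), ?_, fun x => ?_⟩
  · exact contDiff_iff_contDiffAt.2 fun x => ContDiffAt.comp (g := Complex.arg)
      (f := fun x => ((g⁻¹ * c x : Circle) : ℂ)) x (Complex.contDiffAt_arg (hslit x))
      hsmooth.contDiffAt
  · rw [Circle.exp_arg, mul_inv_cancel_left]

/-- The exponential map of the torus. -/
def Torus.exp {n : ℕ} (s : Fin n → ℝ) : Torus n := fun i => Circle.exp (s i)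

theorem Torus.exp_add {n : ℕ} (s t : Fin n → ℝ) : Torus.exp (s + t) = Torus.exp s * Torus.exp t :=
  funext fun i => Circle.exp_add (s i) (t i)

theorem Torus.exp_zero {n : ℕ} : Torus.exp (0 : Fin n → ℝ) = 1 := funext fun _ => Circle.exp_zero

theorem Torus.contMDiff_exp {n : ℕ} :
    ContMDiff 𝓘(ℝ, Fin n → ℝ) (torusModel n) ∞ (Torus.exp (n := n)) :=
  Torus.contMDiff_of_apply fun i =>
    contMDiff_circleExp.comp (contDiff_apply ℝ ℝ i).contMDiff

theorem Torus.extChartAt_target {n : ℕ} (g : Torus n) :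
    (extChartAt (torusModel n) g).target = Set.univ := by
  have h : (chartAt (ModelPi fun _ : Fin n => EuclideanSpace ℝ (Fin 1)) g).target = Set.univ :=
    Set.eq_univ_of_forall fun x i _ => by
      change x i ∈ (chartAt (EuclideanSpace ℝ (Fin 1)) (g i)).target
      rw [Circle.chartAt_target]
      trivial
  rw [_root_.extChartAt_target, h]
  exact Set.eq_univ_of_forall fun x => ⟨trivial, x, rfl⟩

/-- The charts of the torus lift to smooth maps to `ℝⁿ`. -/
theorem Torus.exists_lift_extChartAt_symm {n : ℕ} (g : Torus n) :
    ∃ Θ : (Fin n → EuclideanSpace ℝ (Fin 1)) → Fin n → ℝ, ContDiff ℝ ∞ Θ ∧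
      ∀ x, (extChartAt (torusModel n) g).symm x = g * Torus.exp (Θ x) := by
  choose θ hθ h using fun i => Circle.exists_lift_chart_symm (g i)
  exact ⟨fun x i => θ i (x i), contDiff_pi.2 fun i => (hθ i).comp (contDiff_apply ℝ _ i),
    fun x => funext fun i => h i (x i)⟩

theorem Circle.contMDiff_zpow (k : ℤ) : ContMDiff (𝓡 1) (𝓡 1) ∞ fun z : Circle => z ^ k := by
  cases k with
  | ofNat k => simpa using contMDiff_pow (I := 𝓡 1) (n := ∞) (G := Circle) k
  | negSucc k =>
    simp only [zpow_negSucc]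
    exact (contMDiff_pow (I := 𝓡 1) (n := ∞) (G := Circle) (k + 1)).inv

theorem contMDiff_torusChar {n : ℕ} (k : Fin n → ℤ) :
    ContMDiff (torusModel n) 𝓘(ℝ, ℂ) ∞ (torusChar k) := by
  have h : ContMDiff (torusModel n) (𝓡 1) ∞ fun z : Torus n => ∏ i, z i ^ k i :=
    contMDiff_finsetProd fun i _ => (Circle.contMDiff_zpow (k i)).comp (Torus.contMDiff_apply n i)
  convert Circle.contMDiff_coe.comp h using 1
  ext z
  exact ((map_prod Circle.coeHom (fun i => z i ^ k i) Finset.univ).trans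
    (Finset.prod_congr rfl fun i _ => Circle.coe_zpow (z i) (k i))).symm

theorem torusChar_mul {n : ℕ} (k : Fin n → ℤ) (z w : Torus n) :
    torusChar k (z * w) = torusChar k z * torusChar k w := by
  simp [torusChar, mul_zpow, Finset.prod_mul_distrib]

theorem torusChar_ne_zero {n : ℕ} (k : Fin n → ℤ) (z : Torus n) : torusChar k z ≠ 0 :=
  Finset.prod_ne_zero_iff.2 fun _ _ => zpow_ne_zero _ (Circle.coe_ne_zero _)

end TorusCharts

/-! ### From trivial principal bundles to smooth trivial NCP bundles -/

section FunctionAction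

variable {n d : ℕ} {P : Type u} [TopologicalSpace P] [ChartedSpace (EuclideanSpace ℝ (Fin d)) P]

theorem SmoothFn.isUnit_of_forall_ne_zero {f : SmoothFn d P} (hf : ∀ p, f p ≠ 0) : IsUnit f := by
  have h : ContMDiff (𝓡 d) 𝓘(ℝ, ℂ) ∞ fun p => (f p)⁻¹ := fun p =>
    ((contDiffAt_inv ℝ (hf p)).contMDiffAt.comp p (f.contMDiff p))
  refine IsUnit.of_mul_eq_one (⟨_, h⟩ : SmoothFn d P) ?_
  ext p
  exact mul_inv_cancel₀ (hf p)

variable [IsManifold (𝓡 d) ∞ P]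

/-- The action of the torus on functions induced by a smooth right action is smooth. -/
theorem isSmoothDynamicalSystem_functionAction (σ : RightAction P (Torus n))
    (hσ : σ.IsSmooth (𝓡 d) (torusModel n)) :
    IsSmoothDynamicalSystem (torusModel n) (functionAction σ hσ) := by
  intro g k
  obtain ⟨Θ, hΘ, hΘg⟩ := Torus.exists_lift_extChartAt_symm g
  have hexp : ContMDiff 𝓘(ℝ, Fin n → ℝ) (torusModel n) ∞ fun s => g * Torus.exp s :=
    contMDiff_const.mul Torus.contMDiff_exp
  have hS : ContMDiff (𝓘(ℝ, Fin n → ℝ).prod (𝓡 d)) (𝓡 d) ∞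
      fun z : (Fin n → ℝ) × P => σ.act z.2 (g * Torus.exp z.1) :=
    ContMDiff.comp (g := fun x : P × Torus n => σ.act x.1 x.2)
      (f := fun z : (Fin n → ℝ) × P => (z.2, g * Torus.exp z.1)) hσ
      (contMDiff_snd.prodMk (hexp.comp contMDiff_fst))
  have hSi : ∀ i, ContMDiff (𝓘(ℝ, ℝ).prod (𝓡 d)) (𝓡 d) ∞
      fun z : ℝ × P => σ.act z.2 (Torus.exp (Pi.single i z.1)) := fun i => by
    have hs : ContMDiff 𝓘(ℝ, ℝ) 𝓘(ℝ, Fin n → ℝ) ∞ fun t : ℝ => (Pi.single i t : Fin n → ℝ) :=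
      (ContinuousLinearMap.single ℝ (fun _ : Fin n => ℝ) i).contDiff.contMDiff
    exact ContMDiff.comp (g := fun x : P × Torus n => σ.act x.1 x.2)
      (f := fun z : ℝ × P => (z.2, Torus.exp (Pi.single i z.1))) hσ
      (contMDiff_snd.prodMk ((Torus.contMDiff_exp.comp hs).comp contMDiff_fst))
  let X : Fin n → SmoothFn d P →L[ℝ] SmoothFn d P := fun i =>
    ⟨SmoothFn.generator (hSi i), SmoothFn.continuous_generator (hSi i)⟩
  have hX : ∀ s : ℝ → Fin n → ℝ, ContDiff ℝ ∞ s → ∀ f : SmoothFn d P,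
      Filter.Tendsto (fun t : ℝ => t⁻¹ • (SmoothFn.compFamily hS (s t) f -
        SmoothFn.compFamily hS (s 0) f)) (𝓝[≠] 0)
        (𝓝 (∑ i, deriv s 0 i • SmoothFn.compFamily hS (s 0) (X i f))) := by
    intro s hs f
    have hR : ContMDiff (𝓘(ℝ, ℝ).prod (𝓡 d)) 𝓘(ℝ, ℂ) ∞
        fun z : ℝ × P => f (σ.act z.2 (g * Torus.exp (s z.1))) :=
      (f.contMDiff.comp hS).comp
        (f := fun z : ℝ × P => (s z.1, z.2))
        ((hs.contMDiff.comp contMDiff_fst).prodMk contMDiff_snd)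
    refine SmoothFn.tendsto_slope_of_contMDiff hR (fun _ _ => rfl) fun p => ?_
    set H : (Fin n → ℝ) → ℂ := fun x => f (σ.act p (g * Torus.exp x)) with hH
    have hHs : HasFDerivAt H (fderiv ℝ H (s 0)) (s 0) :=
      (((f.contMDiff.comp hS).contDiff_param p).differentiable (by simp) (s 0)).hasFDerivAt
    have h1 := hHs.comp_hasDerivAt (0 : ℝ) (hs.differentiable (by simp) 0).hasDerivAt
    -- Since `exp (s 0 + t e_i) = exp (s 0) * exp (t e_i)`, the partial derivatives of `H` at `s 0`
    -- are values of the generators at the translated point.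
    have h2 : ∀ i, fderiv ℝ H (s 0) (Pi.single i 1) =
        X i f (σ.act p (g * Torus.exp (s 0))) := by
      intro i
      have h3 := SmoothFn.hasDerivAt_generator (hSi i) f (σ.act p (g * Torus.exp (s 0)))
      have h4 : HasDerivAt (fun t : ℝ => s 0 + Pi.single i t) (Pi.single i (1 : ℝ)) 0 := by
        have := (ContinuousLinearMap.single ℝ (fun _ : Fin n => ℝ) i).hasFDerivAt.comp_hasDerivAt
          (0 : ℝ) (hasDerivAt_id (0 : ℝ))
        exact this.const_add (s 0)
      have h0 : HasFDerivAt H (fderiv ℝ H (s 0)) (s 0 + Pi.single i (0 : ℝ)) := by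
        rwa [Pi.single_zero, add_zero]
      refine (h0.comp_hasDerivAt (0 : ℝ) h4).unique ?_
      have h6 : (H ∘ fun t : ℝ => s 0 + Pi.single i t) = fun t : ℝ =>
          f (σ.act (σ.act p (g * Torus.exp (s 0))) (Torus.exp (Pi.single i t))) := by
        ext t
        simp only [hH, Function.comp_apply, Torus.exp_add, σ.act_mul]
      rw [h6]
      exact h3
    have h5 : (∑ i, deriv s 0 i • SmoothFn.compFamily hS (s 0) (X i f)) p =
        ∑ i, deriv s 0 i • X i f (σ.act p (g * Torus.exp (s 0))) :=
      map_sum (evalChar p) _ _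
    have h6 : fderiv ℝ H (s 0) (deriv s 0) =
        ∑ i, deriv s 0 i • X i f (σ.act p (g * Torus.exp (s 0))) := by
      conv_lhs => rw [pi_eq_sum_univ' (deriv s 0), map_sum]
      refine Finset.sum_congr rfl fun i _ => ?_
      rw [map_smul, ← h2 i]
    rw [h5, ← h6]
    exact h1
  have : ContinuousSMul ℝ (SmoothFn d P) := IsScalarTower.continuousSMul ℂ
  -- The action itself is the case of constant coefficient 1, with `T` the lift `Θ` of the chart to
  -- angles.
  have key := lcContDiffOn_of_generators (SmoothFn.continuous_compFamily hS) hX k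
    (ContinuousLinearMap.fst ℝ (Fin n → EuclideanSpace ℝ (Fin 1)) (SmoothFn d P))
    (b := fun _ => 1) contDiff_const hΘ
    (ContinuousLinearMap.snd ℝ (Fin n → EuclideanSpace ℝ (Fin 1)) (SmoothFn d P))
  rw [Torus.extChartAt_target, Set.univ_prod_univ]
  have h7 : (fun x : (Fin n → EuclideanSpace ℝ (Fin 1)) × SmoothFn d P =>
      functionAction σ hσ ((extChartAt (torusModel n) g).symm x.1) x.2) =
      fun x => (1 : ℝ) • SmoothFn.compFamily hS (Θ x.1) x.2 := by
    ext1 x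
    rw [one_smul, hΘg]
    rfl
  rw [h7]
  exact key

/-- A trivial principal torus bundle gives a smooth trivial NCP torus bundle. -/
theorem isSmoothTrivialNCPTorusBundle_functionAction {m : ℕ} {M : Type*} [TopologicalSpace M]
    [ChartedSpace (EuclideanSpace ℝ (Fin m)) M] {q : P → M} {σ : RightAction P (Torus n)}
    (hσ : σ.IsSmooth (𝓡 d) (torusModel n))
    (h : IsTrivialPrincipalBundle (𝓡 d) (𝓡 m) (torusModel n) q σ) :
    IsSmoothTrivialNCPTorusBundle (functionAction σ hσ) := by
  refine ⟨isSmoothDynamicalSystem_functionAction σ hσ, fun k => ?_⟩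
  obtain ⟨-, φ, -, hφ⟩ := h
  -- The character of the fibre coordinate vanishes nowhere, and equivariance of `φ` makes it
  -- homogeneous of degree `k`.
  let u : SmoothFn d P := ⟨fun p => torusChar k (φ p).2,
    (contMDiff_torusChar k).comp (contMDiff_snd.comp φ.contMDiff)⟩
  refine ⟨u, fun z => ?_, SmoothFn.isUnit_of_forall_ne_zero fun p => torusChar_ne_zero _ _⟩
  ext p
  change torusChar k (φ (σ.act p z)).2 = torusChar k z * torusChar k (φ p).2
  rw [hφ, mul_comm, ← torusChar_mul]
  rfl

end FunctionAction

/-! ### From `C^k`-maps into `C^∞(P)` to jointly smooth functions -/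

section PartialDerivatives

variable {E F : Type*} [NormedAddCommGroup E] [NormedSpace ℝ E] [NormedAddCommGroup F]
  [NormedSpace ℝ F]

/-- A function with partial derivatives of class `C^k` is of class `C^(k+1)`. -/
theorem contDiffOn_succ_of_partial {k : ℕ} {g : ℝ × E → F} {s : Set E} (hs : IsOpen s)
    {g₁ : ℝ × E → F} {g₂ : ℝ × E → E →L[ℝ] F}
    (hg₁ : ∀ z ∈ (Set.univ ×ˢ s : Set (ℝ × E)), HasDerivAt (fun t => g (t, z.2)) (g₁ z) z.1)
    (hg₂ : ∀ z ∈ (Set.univ ×ˢ s : Set (ℝ × E)), HasFDerivAt (fun y => g (z.1, y)) (g₂ z) z.2)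
    (hc₁ : ContDiffOn ℝ k g₁ (Set.univ ×ˢ s)) (hc₂ : ContDiffOn ℝ k g₂ (Set.univ ×ˢ s)) :
    ContDiffOn ℝ (k + 1) g (Set.univ ×ˢ s) := by
  have hO : IsOpen (Set.univ ×ˢ s : Set (ℝ × E)) := isOpen_univ.prod hs
  have hc₁' : ContDiffOn ℝ k (fun z => ContinuousLinearMap.toSpanSingleton ℝ (g₁ z))
      (Set.univ ×ˢ s) :=
    (ContinuousLinearMap.toSpanSingletonCLE (𝕜 := ℝ) (E := F)).contDiff.comp_contDiffOn hc₁
  rw [contDiffOn_succ_iff_hasFDerivWithinAt_of_uniqueDiffOn hO.uniqueDiffOn]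
  refine ⟨fun h => by simp at h, fun z =>
    (ContinuousLinearMap.toSpanSingleton ℝ (g₁ z)).coprod (g₂ z), ?_, fun z hz => ?_⟩
  · have h := (hc₁'.clm_comp (contDiffOn_const (c := ContinuousLinearMap.fst ℝ ℝ E))).add
      (hc₂.clm_comp (contDiffOn_const (c := ContinuousLinearMap.snd ℝ ℝ E)))
    refine h.congr fun z _ => ?_
    ext <;> simp
  · refine HasFDerivAt.hasFDerivWithinAt ?_
    have hev : ∀ᶠ w in 𝓝 z, w ∈ (Set.univ ×ˢ s : Set (ℝ × E)) := hO.mem_nhds hz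
    exact (hasStrictFDerivAt_uncurry_coprod (f := fun t y => g (t, y))
      (f₁ := fun t y => ContinuousLinearMap.toSpanSingleton ℝ (g₁ (t, y)))
      (f₂ := fun t y => g₂ (t, y))
      (hev.mono fun w hw => (hg₁ w hw).hasFDerivAt) (hev.mono fun w hw => hg₂ w hw)
      (hc₁'.continuousOn.continuousAt (hO.mem_nhds hz))
      (hc₂.continuousOn.continuousAt (hO.mem_nhds hz))).hasFDerivAt

end PartialDerivatives

theorem LCContDiffOn.of_succ {k : ℕ} {E : Type u} [AddCommGroup E] [Module ℝ E]
    [TopologicalSpace E] {F : Type v} [AddCommGroup F] [Module ℝ F] [TopologicalSpace F]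
    {f : E → F} {U : Set E} (hf : LCContDiffOn (k + 1) f U) : LCContDiffOn k f U := by
  induction k generalizing E with
  | zero => exact hf.1
  | succ k ih =>
    obtain ⟨hfc, df, hdf, hdfk⟩ := hf
    exact ⟨hfc, df, hdf, ih hdfk⟩

section ExponentialLaw

variable {d : ℕ} {P : Type u} [TopologicalSpace P] [ChartedSpace (EuclideanSpace ℝ (Fin d)) P]
  [IsManifold (𝓡 d) ∞ P]

/-- Convergence in `C^∞(P)` is uniform on a closed ball around `y₀`, and each single derivative is
continuous at `y₀`; together this gives joint continuity. -/
theorem SmoothFn.continuousOn_iteratedFDeriv_family {X : Type*} [TopologicalSpace X]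
    {F : X → SmoothFn d P} (hF : Continuous F)
    {e : OpenPartialHomeomorph P (EuclideanSpace ℝ (Fin d))}
    (he : e ∈ atlas (EuclideanSpace ℝ (Fin d)) P) (j : ℕ) :
    ContinuousOn (fun z : X × EuclideanSpace ℝ (Fin d) =>
      iteratedFDeriv ℝ j (F z.1 ∘ e.symm) z.2) (Set.univ ×ˢ e.target) := by
  rintro ⟨x₀, y₀⟩ ⟨-, hy₀⟩
  refine ContinuousAt.continuousWithinAt (Metric.tendsto_nhds.2 fun ε hε => ?_)
  obtain ⟨r, hr, hball⟩ := Metric.nhds_basis_closedBall.mem_iff.1 (e.open_target.mem_nhds hy₀)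
  have h1 := SmoothFn.eventually_of_tendsto (hF.tendsto x₀) he hball (isCompact_closedBall _ _) j
    (half_pos hε)
  have h2 : ContinuousAt (iteratedFDeriv ℝ j (F x₀ ∘ e.symm)) y₀ :=
    (((F x₀).contDiffOn he).iteratedFDeriv_of_isOpen e.open_target j).continuousOn.continuousAt
      (e.open_target.mem_nhds hy₀)
  filter_upwards [(continuous_fst.tendsto (x₀, y₀)).eventually h1,
    (continuous_snd.tendsto (x₀, y₀)).eventually (Metric.closedBall_mem_nhds y₀ hr),
    (continuous_snd.tendsto (x₀, y₀)).eventually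
      (Metric.tendsto_nhds.1 h2 _ (half_pos hε))] with z hz1 hz2 hz3
  have h3 := hz1 z.2 hz2
  rw [← dist_eq_norm] at h3
  exact (dist_triangle _ _ _).trans_lt (by linarith)

/-- Along affine lines, a `C^k`-map into `C^∞(P)` is jointly `C^k`, with all its derivatives in
the direction of `P`. -/
theorem LCContDiffOn.contDiffOn_iteratedFDeriv_line (k : ℕ) {Y : Type v} [AddCommGroup Y]
    [Module ℝ Y] [TopologicalSpace Y] [ContinuousAdd Y] [ContinuousSMul ℝ Y] {U : Set Y}
    {Γ : Y → SmoothFn d P} (hΓ : LCContDiffOn k Γ U) (y h : Y) (hU : ∀ t : ℝ, y + t • h ∈ U)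
    {e : OpenPartialHomeomorph P (EuclideanSpace ℝ (Fin d))}
    (he : e ∈ atlas (EuclideanSpace ℝ (Fin d)) P) (j : ℕ) :
    ContDiffOn ℝ k (fun z : ℝ × EuclideanSpace ℝ (Fin d) =>
      iteratedFDeriv ℝ j (Γ (y + z.1 • h) ∘ e.symm) z.2) (Set.univ ×ˢ e.target) := by
  have hcont : ∀ {Y : Type v} [AddCommGroup Y] [Module ℝ Y] [TopologicalSpace Y]
      [ContinuousAdd Y] [ContinuousSMul ℝ Y] {U : Set Y} {Γ : Y → SmoothFn d P}
      (_ : ContinuousOn Γ U) (y h : Y) (_ : ∀ t : ℝ, y + t • h ∈ U) (j : ℕ),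
      ContinuousOn (fun z : ℝ × EuclideanSpace ℝ (Fin d) =>
        iteratedFDeriv ℝ j (Γ (y + z.1 • h) ∘ e.symm) z.2) (Set.univ ×ˢ e.target) :=
    fun hΓ y h hU j => SmoothFn.continuousOn_iteratedFDeriv_family
      (hΓ.comp_continuous (continuous_const.add (continuous_id.smul continuous_const)) hU) he j
  have hO : IsOpen (Set.univ ×ˢ e.target : Set (ℝ × EuclideanSpace ℝ (Fin d))) :=
    isOpen_univ.prod e.open_target
  induction k generalizing Y j with
  | zero => exact contDiffOn_zero.2 (hcont hΓ.continuousOn y h hU j)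
  | succ k ih =>
    obtain ⟨hΓc, dΓ, hdΓ, hdΓk⟩ := hΓ
    -- The `t`-derivative of `Γ (y + t h)` is `dΓ (y + t h, h)`, which is `dΓ` along the line
    -- through `(y, h)` in direction `(h, 0)`. The induction hypothesis for `dΓ` covers this partial
    -- derivative; for `Γ` with `j + 1` it covers the one along `P`.
    have hU' : ∀ t : ℝ, (y, h) + t • (h, (0 : Y)) ∈ U ×ˢ (Set.univ : Set Y) := fun t =>
      ⟨hU t, trivial⟩
    have hΓk : LCContDiffOn k Γ U := LCContDiffOn.of_succ ⟨hΓc, dΓ, hdΓ, hdΓk⟩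
    have h1 := ih hdΓk (y, h) (h, 0) hU' j
    have h2 := ih hΓk y h hU (j + 1)
    let κ := continuousMultilinearCurryLeftEquiv ℝ
      (fun _ : Fin (j + 1) => EuclideanSpace ℝ (Fin d)) ℂ
    refine contDiffOn_succ_of_partial e.open_target ?_ ?_ h1
      (κ.toContinuousLinearEquiv.contDiff.comp_contDiffOn h2)
    · rintro ⟨t, η⟩ ⟨-, hη⟩
      rw [hasDerivAt_iff_tendsto_slope_zero]
      have h3 := SmoothFn.tendsto_iteratedFDeriv (hdΓ (y + t • h) (hU t) h) he hη j
      dsimp only at h3 ⊢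
      have h4 : (y, h) + t • (h, (0 : Y)) = (y + t • h, h) := by simp
      rw [h4]
      refine h3.congr fun t' => ?_
      rw [add_assoc, ← add_smul, ← SmoothFn.iteratedFDeriv_sub_apply _ _ he hη]
      exact iteratedFDeriv_const_smul_apply (a := t'⁻¹)
        ((SmoothFn.contDiffAt _ he hη).of_le (m := j) (by exact_mod_cast le_top))
    · rintro ⟨t, η⟩ ⟨-, hη⟩
      have h3 := ((((Γ (y + t • h)).contDiffOn he).iteratedFDeriv_of_isOpen e.open_target
        j).contDiffAt (e.open_target.mem_nhds hη)).differentiableAt (by simp)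
      exact h3.hasFDerivAt

/-- The part of the exponential law that the torus action needs: with a one-dimensional parameter,
only one pair of partial derivatives has to be controlled at each order. -/
theorem LCSmoothOn.contMDiff_line {Y : Type v} [AddCommGroup Y]
    [Module ℝ Y] [TopologicalSpace Y] [ContinuousAdd Y] [ContinuousSMul ℝ Y] {U : Set Y}
    {Γ : Y → SmoothFn d P} (hΓ : LCSmoothOn Γ U) (y h : Y) (hU : ∀ t : ℝ, y + t • h ∈ U) :
    ContMDiff (𝓘(ℝ, ℝ).prod (𝓡 d)) 𝓘(ℝ, ℂ) ∞ fun z : ℝ × P => Γ (y + z.1 • h) z.2 := by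
  rintro ⟨t, p⟩
  have he := chart_mem_atlas (EuclideanSpace ℝ (Fin d)) p
  set e := chartAt (EuclideanSpace ℝ (Fin d)) p
  have h1 : ContDiffOn ℝ ∞ (fun z : ℝ × EuclideanSpace ℝ (Fin d) =>
      Γ (y + z.1 • h) (e.symm z.2)) (Set.univ ×ˢ e.target) := by
    refine contDiffOn_infty.2 fun k => ?_
    exact (ContinuousMultilinearMap.apply ℝ (fun _ : Fin 0 => EuclideanSpace ℝ (Fin d)) ℂ
      0).contDiff.comp_contDiffOn
        ((hΓ k).contDiffOn_iteratedFDeriv_line k y h hU he 0)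
  have h2 : ContMDiffOn (𝓘(ℝ, ℝ).prod (𝓡 d)) 𝓘(ℝ, ℝ × EuclideanSpace ℝ (Fin d)) ∞
      (fun z : ℝ × P => (z.1, e z.2)) (Set.univ ×ˢ e.source) := by
    rw [modelWithCornersSelf_prod, ← chartedSpaceSelf_prod]
    exact contMDiff_fst.contMDiffOn.prodMk
      ((contMDiffOn_of_mem_maximalAtlas (IsManifold.subset_maximalAtlas he)).comp
        contMDiff_snd.contMDiffOn fun z hz => hz.2)
  have h3 := h1.contMDiffOn.comp h2 fun z hz => ⟨trivial, e.map_source hz.2⟩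
  have hO : IsOpen (Set.univ ×ˢ e.source : Set (ℝ × P)) := isOpen_univ.prod e.open_source
  have hm : (t, p) ∈ (Set.univ ×ˢ e.source : Set (ℝ × P)) := ⟨trivial, mem_chart_source _ p⟩
  refine (h3.contMDiffAt (hO.mem_nhds hm)).congr_of_eventuallyEq ?_
  filter_upwards [hO.mem_nhds hm] with z hz
  simp only [Function.comp_apply, e.left_inv hz.2]

end ExponentialLaw

/-! ### Points of `P` as characters of `C^∞(P)` -/

section Characters

variable {d : ℕ} {P : Type u} [TopologicalSpace P] [ChartedSpace (EuclideanSpace ℝ (Fin d)) P]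

/-- A smooth real-valued function as a complex-valued one. -/
def SmoothFn.ofReal {g : P → ℝ} (hg : ContMDiff (𝓡 d) 𝓘(ℝ, ℝ) ∞ g) : SmoothFn d P :=
  ⟨fun p => (g p : ℂ), Complex.ofRealCLM.contDiff.contMDiff.comp hg⟩

/-- The square of the absolute value of a smooth function. -/
def SmoothFn.normSq (f : SmoothFn d P) : SmoothFn d P :=
  f * ⟨fun p => (starRingEnd ℂ) (f p), Complex.conjCLE.contDiff.contMDiff.comp f.contMDiff⟩

theorem SmoothFn.normSq_apply (f : SmoothFn d P) (p : P) :
    f.normSq p = (Complex.normSq (f p) : ℂ) := Complex.mul_conj (f p)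

/-- `|f|²` is a multiple of `f`, so it lies in every ideal containing `f`; no compatibility of `χ`
with conjugation is used. -/
theorem SmoothFn.map_normSq_eq_zero (χ : SmoothFn d P →ₐ[ℂ] ℂ) {f : SmoothFn d P} (hf : χ f = 0) :
    χ f.normSq = 0 :=
  (map_mul χ f _).trans (by rw [hf, zero_mul])

/-- Near `x` the index `K.find` of a compact exhaustion is at most `K.find x + 1`. A partition of
unity glues these constants to a smooth `g ≥ K.find`, and then `{g ≤ c}` lies in a member of the
exhaustion. -/
theorem exists_contMDiff_preimage_subset_compact [T2Space P] [SecondCountableTopology P]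
    [IsManifold (𝓡 d) ∞ P] : ∃ g : P → ℝ, ContMDiff (𝓡 d) 𝓘(ℝ, ℝ) ∞ g ∧
      ∀ c : ℝ, IsCompact {p | g p ≤ c} := by
  have : LocallyCompactSpace P := ChartedSpace.locallyCompactSpace (EuclideanSpace ℝ (Fin d)) P
  let K := CompactExhaustion.choice P
  obtain ⟨g, hg⟩ := exists_contMDiffMap_forall_mem_convex_of_local_const (n := ⊤) (𝓡 d)
    (t := fun x : P => Set.Ici (K.find x : ℝ)) (fun x => convex_Ici _) (fun x => by
      refine ⟨(K.find x + 1 : ℕ), ?_⟩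
      filter_upwards [mem_interior_iff_mem_nhds.1 (K.subset_interior_succ _ (K.mem_find x))]
        with y hy
      exact Set.mem_Ici.2 <| Nat.cast_le.2 (K.mem_iff_find_le.1 hy))
  refine ⟨g, g.contMDiff, fun c => ?_⟩
  refine (K.isCompact ⌈c⌉₊).of_isClosed_subset
    (isClosed_le g.contMDiff.continuous continuous_const) fun p hp => ?_
  refine K.mem_iff_find_le.2 ?_
  have h1 : (K.find p : ℝ) ≤ c := (hg p).trans hp
  exact_mod_cast h1.trans (Nat.le_ceil c)

/-- Every character of `C^∞(P)` is the evaluation at a point. -/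
theorem exists_eq_evalChar [T2Space P] [SecondCountableTopology P] [IsManifold (𝓡 d) ∞ P]
    (χ : SmoothFn d P →ₐ[ℂ] ℂ) : ∃ p, χ = evalChar p := by
  by_contra! hχ
  obtain ⟨g, hg, hgK⟩ := exists_contMDiff_preimage_subset_compact (d := d) (P := P)
  have hker : ∀ f : SmoothFn d P, χ (f - algebraMap ℂ _ (χ f)) = 0 := fun f => by
    rw [map_sub, AlgHom.commutes, Algebra.algebraMap_self_apply, sub_self]
  set ρ := SmoothFn.ofReal hg with hρ
  -- An element of the kernel of `χ` whose zero set lies in a sublevel set of `g`, hence is compact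
  -- even if `P` is not.
  set ρ' := ρ - algebraMap ℂ _ (χ ρ) with hρ'
  have hρ'p : ∀ p, ρ' p = g p - χ ρ := fun p => rfl
  have hcl : IsClosed {p | ρ' p = 0} := isClosed_eq ρ'.contMDiff.continuous continuous_const
  have hcomp : IsCompact {p | ρ' p = 0} := by
    refine (hgK (χ ρ).re).of_isClosed_subset hcl fun p hp => ?_
    have h1 : (g p : ℂ) = χ ρ := sub_eq_zero.1 ((hρ'p p).symm.trans hp)
    change g p ≤ (χ ρ).re
    rw [← h1, Complex.ofReal_re]
  -- As `χ` differs from every evaluation, each point has a kernel element not vanishing there. A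
  -- finite sum of their squared moduli is a kernel element `h ≥ 0` that is positive on the zero set
  -- of `ρ'`; `r` records its real values.
  obtain ⟨h, hχh, r, hr, hpos⟩ := hcomp.induction_on
    (p := fun s => ∃ h : SmoothFn d P, χ h = 0 ∧ ∃ r : P → ℝ, (∀ x, 0 ≤ r x ∧ h x = r x) ∧
      ∀ x ∈ s, 0 < r x)
    ⟨0, map_zero χ, 0, fun x => ⟨le_rfl, by simp⟩, fun x hx => hx.elim⟩
    (by
      rintro s t hst ⟨h, h1, r, h2, h3⟩
      exact ⟨h, h1, r, h2, fun x hx => h3 x (hst hx)⟩)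
    (by
      rintro s t ⟨h, h1, r, h2, h3⟩ ⟨h', h1', r', h2', h3'⟩
      refine ⟨h + h', by rw [map_add, h1, h1', add_zero], r + r',
        fun x => ⟨add_nonneg (h2 x).1 (h2' x).1, ?_⟩, ?_⟩
      · rw [Pi.add_apply, Complex.ofReal_add, ← (h2 x).2, ← (h2' x).2]
        rfl
      · rintro x (hx | hx)
        · exact add_pos_of_pos_of_nonneg (h3 x hx) (h2' x).1
        · exact add_pos_of_nonneg_of_pos (h2 x).1 (h3' x hx))
    (by
      intro p _
      obtain ⟨f, hf⟩ : ∃ f, χ f ≠ evalChar p f := by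
        by_contra! H
        exact hχ p (AlgHom.ext H)
      set f' := f - algebraMap ℂ _ (χ f) with hf'
      have hf'p : f' p ≠ 0 := fun H => hf (sub_eq_zero.1 H).symm
      refine ⟨{x | f' x ≠ 0}, nhdsWithin_le_nhds
        (f'.contMDiff.continuous.continuousAt.eventually_ne hf'p), f'.normSq,
        SmoothFn.map_normSq_eq_zero χ (hker f), fun x => Complex.normSq (f' x),
        fun x => ⟨Complex.normSq_nonneg _, f'.normSq_apply x⟩, fun x hx =>
          Complex.normSq_pos.2 hx⟩)
  -- The contradiction: this element of the kernel of `χ` is positive everywhere, hence invertible.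
  have hu : IsUnit (h + ρ'.normSq) := by
    refine SmoothFn.isUnit_of_forall_ne_zero fun p => ?_
    have h1 : (h + ρ'.normSq) p = ((r p + Complex.normSq (ρ' p) : ℝ) : ℂ) := by
      rw [Complex.ofReal_add, ← (hr p).2, ← ρ'.normSq_apply]
      rfl
    rw [h1, Complex.ofReal_ne_zero]
    by_cases hp : ρ' p = 0
    · exact (add_pos_of_pos_of_nonneg (hpos p hp) (Complex.normSq_nonneg _)).ne'
    · exact (add_pos_of_nonneg_of_pos (hr p).1 (Complex.normSq_pos.2 hp)).ne'
  refine (hu.map χ).ne_zero ?_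
  rw [map_add, hχh, SmoothFn.map_normSq_eq_zero χ (hker ρ), add_zero]

theorem evalChar_injective [T2Space P] [IsManifold (𝓡 d) ∞ P] :
    Function.Injective (evalChar : P → SmoothFn d P →ₐ[ℂ] ℂ) := by
  intro p q hpq
  by_contra hne
  obtain ⟨ψ, -, hψ⟩ := (SmoothBumpFunction.nhds_basis_support (I := 𝓡 d) (c := p)
    (isOpen_compl_singleton.mem_nhds hne)).mem_iff.1 (isOpen_compl_singleton.mem_nhds hne)
  have h := congrArg (fun χ => χ (SmoothFn.ofReal ψ.contMDiff)) hpq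
  have h' : ((ψ p : ℝ) : ℂ) = (ψ q : ℝ) := h
  rw [ψ.eq_one, Function.notMem_support.1 fun hq => hψ hq rfl] at h'
  simp at h'

/-- A map into a manifold is smooth if its compositions with all smooth functions are. -/
theorem contMDiff_of_forall_smoothFn [T2Space P] [IsManifold (𝓡 d) ∞ P] {E : Type*}
    [NormedAddCommGroup E] [NormedSpace ℝ E] {H : Type*} [TopologicalSpace H]
    {I : ModelWithCorners ℝ E H} {N : Type*} [TopologicalSpace N] [ChartedSpace H N] {g : N → P}
    (hg : ∀ f : SmoothFn d P, ContMDiff I 𝓘(ℝ, ℂ) ∞ fun x => f (g x)) :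
    ContMDiff I (𝓡 d) ∞ g := by
  intro x
  have hreal : ∀ {r : P → ℝ}, ContMDiff (𝓡 d) 𝓘(ℝ, ℝ) ∞ r →
      ContMDiff I 𝓘(ℝ, ℝ) ∞ fun x => r (g x) := fun hr =>
    Complex.reCLM.contDiff.contMDiff.comp (hg (SmoothFn.ofReal hr))
  have hcont : ContinuousAt g x := by
    intro U hU
    obtain ⟨ψ, -, hψ⟩ := (SmoothBumpFunction.nhds_basis_support (I := 𝓡 d) (c := g x)
      hU).mem_iff.1 hU
    have h1 : ∀ᶠ y in 𝓝 x, ψ (g y) ≠ 0 :=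
      (hreal ψ.contMDiff).continuous.continuousAt.eventually_ne (by rw [ψ.eq_one]; exact one_ne_zero)
    exact h1.mono fun y hy => hψ hy
  rw [contMDiffAt_iff_target]
  refine ⟨hcont, ?_⟩
  obtain ⟨ψ, -, -⟩ := (SmoothBumpFunction.nhds_basis_support (I := 𝓡 d) (c := g x)
    Filter.univ_mem).mem_iff.1 Filter.univ_mem
  set e := extChartAt (𝓡 d) (g x) with he
  -- The cut-off makes the chart a globally smooth map, whose coordinates the hypothesis can test;
  -- near `g x` nothing is changed because `ψ = 1` there.
  have hF : ContMDiff (𝓡 d) 𝓘(ℝ, EuclideanSpace ℝ (Fin d)) ∞ fun p => ψ p • e p :=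
    ψ.contMDiff_smul contMDiffOn_extChartAt
  have hcoord : ∀ i, ContMDiff I 𝓘(ℝ, ℝ) ∞ fun y => (ψ (g y) • e (g y)) i := fun i =>
    hreal ((EuclideanSpace.proj (𝕜 := ℝ) i).contDiff.contMDiff.comp hF)
  have h1 : ContMDiff I 𝓘(ℝ, EuclideanSpace ℝ (Fin d)) ∞ fun y => ψ (g y) • e (g y) :=
    (EuclideanSpace.equiv (Fin d) ℝ).symm.contDiff.contMDiff.comp (contMDiff_pi_space.2 hcoord)
  refine (h1 x).congr_of_eventuallyEq ?_
  filter_upwards [hcont.eventually ψ.eventuallyEq_one] with y hy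
  rw [Function.comp_apply, hy, Pi.one_apply, one_smul]

end Characters

/-! ### The induced action on `P` and its smoothness -/

section InducedAction

variable {n d : ℕ} {P : Type u} [TopologicalSpace P] [ChartedSpace (EuclideanSpace ℝ (Fin d)) P]
  [IsManifold (𝓡 d) ∞ P] {α : Torus n →* (SmoothFn d P ≃ₐ[ℂ] SmoothFn d P)}

/-- `δ_p ∘ α(z)` is a character, hence an evaluation. The action laws are those of `α`, read through
the injectivity of `p ↦ δ_p`; `δ_p ∘ α(g) ∘ α(h)` gives a right action. -/
theorem exists_isInducedAction [T2Space P] [SecondCountableTopology P] {G : Type*} [Group G]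
    (α : G →* (SmoothFn d P ≃ₐ[ℂ] SmoothFn d P)) : ∃ σ : RightAction P G, IsInducedAction α σ := by
  choose act hact using fun (p : P) (z : G) =>
    exists_eq_evalChar ((evalChar p).comp (α z : SmoothFn d P →ₐ[ℂ] SmoothFn d P))
  refine ⟨⟨act, fun p => evalChar_injective (d := d) ?_,
    fun p g h => evalChar_injective (d := d) ?_⟩,
    fun p z => (hact p z).symm⟩
  · rw [← hact, map_one]
    rfl
  · rw [← hact, ← hact, ← hact, map_mul]
    rfl

theorem IsInducedAction.unique [T2Space P] {G : Type*} [Group G]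
    {α : G →* (SmoothFn d P ≃ₐ[ℂ] SmoothFn d P)} {σ σ' : RightAction P G}
    (h : IsInducedAction α σ) (h' : IsInducedAction α σ') : σ' = σ :=
  RightAction.ext (funext fun p => funext fun g => evalChar_injective ((h' p g).trans (h p g).symm))

theorem IsInducedAction.apply_act {G : Type*} [Group G]
    {α : G →* (SmoothFn d P ≃ₐ[ℂ] SmoothFn d P)} {σ : RightAction P G} (h : IsInducedAction α σ)
    (f : SmoothFn d P) (p : P) (g : G) : f (σ.act p g) = α g f p :=
  congrArg (fun χ : SmoothFn d P →ₐ[ℂ] ℂ => χ f) (h p g)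

/-- Smoothness of the induced action of a single circle factor. -/
theorem IsInducedAction.contMDiff_mulSingle [T2Space P]
    (hα : IsSmoothDynamicalSystem (torusModel n) α) {σ : RightAction P (Torus n)}
    (h : IsInducedAction α σ) (i : Fin n) :
    ContMDiff ((𝓡 d).prod (𝓡 1)) (𝓡 d) ∞
      fun x : P × Circle => σ.act x.1 (Pi.mulSingle i x.2) := by
  refine contMDiff_of_forall_smoothFn fun f => ?_
  simp only [h.apply_act]
  rintro ⟨p₀, z₀⟩
  have : ContinuousSMul ℝ (SmoothFn d P) := IsScalarTower.continuousSMul ℂ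
  set g : Torus n := Pi.mulSingle i z₀ with hg
  have hgi : g i = z₀ := by rw [hg, Pi.mulSingle_eq_same]
  have hΓ := hα g
  rw [Torus.extChartAt_target, Set.univ_prod_univ] at hΓ
  -- In the chart at `g` the `i`-th circle factor is the line `y + t w`: only coordinate `i` moves,
  -- starting from 0, and the others stay at the chart values of `g j = 1`. The entire line is
  -- admissible because the chart target is the whole space.
  set y : Fin n → EuclideanSpace ℝ (Fin 1) :=
    Function.update (fun j => chartAt (EuclideanSpace ℝ (Fin 1)) (g j) (g j)) i 0 with hy
  set w : Fin n → EuclideanSpace ℝ (Fin 1) := Pi.single i (EuclideanSpace.single 0 1) with hw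
  have h1 := hΓ.contMDiff_line (y, f) (w, 0) fun _ => trivial
  set c := chartAt (EuclideanSpace ℝ (Fin 1)) z₀ with hc
  have hcs : ContMDiffOn (𝓡 1) 𝓘(ℝ, ℝ) ∞ (fun z : Circle => c z 0) c.source :=
    (EuclideanSpace.proj (𝕜 := ℝ) (0 : Fin 1)).contDiff.contMDiff.comp_contMDiffOn
      contMDiffOn_chart
  have hO : IsOpen (Set.univ ×ˢ c.source : Set (P × Circle)) := isOpen_univ.prod c.open_source
  have hm : (p₀, z₀) ∈ (Set.univ ×ˢ c.source : Set (P × Circle)) :=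
    ⟨trivial, mem_chart_source _ z₀⟩
  have h2 : ContMDiffOn ((𝓡 d).prod (𝓡 1)) (𝓘(ℝ, ℝ).prod (𝓡 d)) ∞
      (fun x : P × Circle => (c x.2 0, x.1)) (Set.univ ×ˢ c.source) :=
    (hcs.comp contMDiff_snd.contMDiffOn fun x hx => hx.2).prodMk contMDiff_fst.contMDiffOn
  have h3 := h1.comp_contMDiffOn h2
  refine (h3.contMDiffAt (hO.mem_nhds hm)).congr_of_eventuallyEq ?_
  filter_upwards [hO.mem_nhds hm] with x hx
  have h4 : (extChartAt (torusModel n) g).symm (y + c x.2 0 • w) = Pi.mulSingle i x.2 := by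
    ext1 j
    change (chartAt (EuclideanSpace ℝ (Fin 1)) (g j)).symm ((y + c x.2 0 • w) j) = _
    by_cases hj : j = i
    · subst hj
      have h5 : (y + c x.2 0 • w) j = c x.2 := by
        ext k
        rw [Subsingleton.elim k 0]
        simp [hy, hw]
      rw [h5, Pi.mulSingle_eq_same, hgi]
      exact c.left_inv hx.2
    · have h5 : (y + c x.2 0 • w) j = chartAt (EuclideanSpace ℝ (Fin 1)) (g j) (g j) := by
        simp [hy, hw, Function.update_of_ne hj, Pi.single_eq_of_ne hj]
      rw [h5, OpenPartialHomeomorph.left_inv _ (mem_chart_source _ _), Pi.mulSingle_eq_of_ne hj,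
        hg, Pi.mulSingle_eq_of_ne hj]
  simp only [Function.comp_apply, Prod.smul_mk, Prod.mk_add_mk, smul_zero, add_zero, h4]

/-- The right action induced by a smooth dynamical system is smooth. -/
theorem IsInducedAction.isSmooth [T2Space P]
    (hα : IsSmoothDynamicalSystem (torusModel n) α) {σ : RightAction P (Torus n)}
    (h : IsInducedAction α σ) : σ.IsSmooth (𝓡 d) (torusModel n) := by
  -- Smoothness is known for one circle factor at a time. As `z` is the product of its components,
  -- `σ (·, z)` is a composite of such actions.
  have key : ∀ s : Finset (Fin n), ContMDiff ((𝓡 d).prod (torusModel n)) (𝓡 d) ∞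
      fun x : P × Torus n => σ.act x.1 (∏ i ∈ s, Pi.mulSingle i (x.2 i)) := by
    intro s
    induction s using Finset.induction_on with
    | empty =>
      simp only [Finset.prod_empty, σ.act_one]
      exact contMDiff_fst
    | insert i s hi ih =>
      simp only [Finset.prod_insert hi, σ.act_mul]
      have h1 : ContMDiff ((𝓡 d).prod (torusModel n)) (𝓡 d) ∞
          fun x : P × Torus n => σ.act x.1 (Pi.mulSingle i (x.2 i)) :=
        (h.contMDiff_mulSingle hα i).comp (f := fun x : P × Torus n => (x.1, x.2 i))
          (contMDiff_fst.prodMk ((Torus.contMDiff_apply n i).comp contMDiff_snd))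
      exact ih.comp (f := fun x : P × Torus n => (σ.act x.1 (Pi.mulSingle i (x.2 i)), x.2))
        (h1.prodMk contMDiff_snd)
  have h1 := key Finset.univ
  simp only [Finset.univ_prod_mulSingle] at h1
  exact h1

end InducedAction

/-! ### Local inverses and completion of submersions to coordinates -/

section InverseFunction

/-- The inverse function theorem, with a smooth inverse on the whole target. -/
theorem ContDiffOn.exists_openPartialHomeomorph {E F : Type*} [NormedAddCommGroup E]
    [NormedSpace ℝ E] [CompleteSpace E] [NormedAddCommGroup F] [NormedSpace ℝ F] {f : E → F}
    {s : Set E} (hs : IsOpen s) (hf : ContDiffOn ℝ ∞ f s) {x : E} (hx : x ∈ s) {A : E ≃L[ℝ] F}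
    (hA : HasFDerivAt f (A : E →L[ℝ] F) x) :
    ∃ Ψ : OpenPartialHomeomorph E F, x ∈ Ψ.source ∧ Ψ.source ⊆ s ∧ ⇑Ψ = f ∧
      ContDiffOn ℝ ∞ Ψ.symm Ψ.target := by
  have hfx := hf.contDiffAt (hs.mem_nhds hx)
  let Ψ₀ := hfx.toOpenPartialHomeomorph f hA (by simp)
  have hdf : ContinuousOn (fderiv ℝ f) s :=
    (hf.fderiv_of_isOpen hs (m := ∞) (by norm_cast)).continuousOn
  -- Restricting to points with invertible derivative makes the inverse smooth on all of its domain,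
  -- not only at `f x`.
  set O := s ∩ fderiv ℝ f ⁻¹' Set.range ((↑) : (E ≃L[ℝ] F) → E →L[ℝ] F) with hO
  have hOo : IsOpen O := hdf.isOpen_inter_preimage hs ContinuousLinearEquiv.isOpen
  refine ⟨Ψ₀.restrOpen O hOo, ?_, ?_, rfl, ?_⟩
  · exact ⟨hfx.mem_toOpenPartialHomeomorph_source hA (by simp), hx, A, hA.fderiv.symm⟩
  · exact fun y hy => hy.2.1
  · intro y hy
    have hy' := (Ψ₀.restrOpen O hOo).map_target hy
    obtain ⟨hys, B, hB⟩ := hy'.2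
    refine ((Ψ₀.restrOpen O hOo).contDiffAt_symm (f₀' := B) hy ?_ ?_).contDiffWithinAt
    · rw [hB]
      exact ((hf.contDiffAt (hs.mem_nhds hys)).differentiableAt (by simp)).hasFDerivAt
    · exact hf.contDiffAt (hs.mem_nhds hys)

/-- A surjective linear map can be completed to a linear equivalence. -/
theorem ContinuousLinearMap.exists_equiv_prod_of_surjective {d n : ℕ}
    (L : EuclideanSpace ℝ (Fin d) →L[ℝ] (Fin n → ℝ)) (hL : Function.Surjective L) :
    ∃ A : EuclideanSpace ℝ (Fin d) ≃L[ℝ] (Fin n → ℝ) × EuclideanSpace ℝ (Fin (d - n)),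
      ∀ x, (A x).1 = L x := by
  have hr : (L : EuclideanSpace ℝ (Fin d) →ₗ[ℝ] (Fin n → ℝ)).range = ⊤ :=
    LinearMap.range_eq_top.2 hL
  obtain ⟨C, hC⟩ :=
    Submodule.exists_isCompl (L : EuclideanSpace ℝ (Fin d) →ₗ[ℝ] (Fin n → ℝ)).ker
  let B := LinearMap.equivProdOfSurjectiveOfIsCompl
    (L : EuclideanSpace ℝ (Fin d) →ₗ[ℝ] (Fin n → ℝ)) (Submodule.projectionOnto _ C hC) hr
    (Submodule.range_projectionOnto hC) (by rwa [Submodule.ker_projectionOnto])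
  -- Rank-nullity gives `n + dim ker L = d`, so the subtraction in `d - n` is not truncated.
  have hdim : Module.finrank ℝ (L : EuclideanSpace ℝ (Fin d) →ₗ[ℝ] (Fin n → ℝ)).ker =
      Module.finrank ℝ (EuclideanSpace ℝ (Fin (d - n))) := by
    have h := LinearMap.finrank_range_add_finrank_ker
      (L : EuclideanSpace ℝ (Fin d) →ₗ[ℝ] (Fin n → ℝ))
    rw [hr, finrank_top, Module.finrank_fin_fun, finrank_euclideanSpace_fin] at h
    rw [finrank_euclideanSpace_fin]
    omega
  refine ⟨(B.trans ((LinearEquiv.refl ℝ (Fin n → ℝ)).prodCongr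
    (LinearEquiv.ofFinrankEq _ _ hdim))).toContinuousLinearEquiv, fun x => rfl⟩

end InverseFunction

/-! ### The equivariant map to the torus -/

section EquivariantMap

variable {n d : ℕ} {P : Type u} [TopologicalSpace P] [ChartedSpace (EuclideanSpace ℝ (Fin d)) P]

theorem Circle.contMDiff_of_coe {E : Type*} [NormedAddCommGroup E] [NormedSpace ℝ E]
    {H : Type*} [TopologicalSpace H] {I : ModelWithCorners ℝ E H} {M : Type*} [TopologicalSpace M]
    [ChartedSpace H M] [IsManifold I ∞ M] {f : M → Circle} (hf : ContMDiff I 𝓘(ℝ, ℂ) ∞ fun x => (f x : ℂ)) :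
    ContMDiff I (𝓡 1) ∞ f :=
  have : Fact (Module.finrank ℝ ℂ = 1 + 1) := Complex.finrank_real_complex_fact
  hf.codRestrict_sphere fun x => (f x).2

theorem torusChar_single {n : ℕ} (i : Fin n) (z : Torus n) :
    torusChar (Pi.single i 1) z = z i := by
  rw [torusChar, Finset.prod_eq_single i]
  · simp
  · intro j _ hj
    simp [Pi.single_eq_of_ne hj]
  · simp

/-- Invertible elements in the isotypic components yield an equivariant map to the torus. -/
theorem IsSmoothTrivialNCPTorusBundle.exists_equivariant [IsManifold (𝓡 d) ∞ P]
    {α : Torus n →* (SmoothFn d P ≃ₐ[ℂ] SmoothFn d P)} (hα : IsSmoothTrivialNCPTorusBundle α)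
    {σ : RightAction P (Torus n)} (h : IsInducedAction α σ) :
    ∃ v : P → Torus n, ContMDiff (𝓡 d) (torusModel n) ∞ v ∧
      ∀ p z, v (σ.act p z) = v p * z := by
  -- Only the unit vectors of `ℤⁿ` are needed. Dividing `w i` by its modulus preserves equivariance
  -- because `|z i| = 1`.
  choose w hw hwu using fun i : Fin n => hα.exists_isUnit (Pi.single i 1)
  have hne : ∀ i p, w i p ≠ 0 := fun i p => ((hwu i).map (evalChar p)).ne_zero
  have hact : ∀ i p z, w i (σ.act p z) = z i * w i p := fun i p z => by
    rw [h.apply_act, hw i z, torusChar_single]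
    rfl
  have hn : ∀ i p, (w i p / ‖w i p‖ : ℂ) ∈ Submonoid.unitSphere ℂ := fun i p => by
    refine mem_sphere_zero_iff_norm.2 ?_
    rw [norm_div, Complex.norm_real, norm_norm,
      div_self (norm_ne_zero_iff.2 (hne i p))]
  refine ⟨fun p i => ⟨_, hn i p⟩, Torus.contMDiff_of_apply fun i => ?_, fun p z => ?_⟩
  · refine Circle.contMDiff_of_coe fun p => ?_
    have h1 : ContDiffAt ℝ ∞ (fun z : ℂ => (‖z‖ : ℂ)) (w i p) :=
      Complex.ofRealCLM.contDiff.contDiffAt.comp _ (contDiffAt_norm ℝ (hne i p))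
    have h2 : ContDiffAt ℝ ∞ (fun z : ℂ => z * (‖z‖ : ℂ)⁻¹) (w i p) :=
      contDiffAt_id.mul (h1.inv (Complex.ofReal_ne_zero.2 (norm_ne_zero_iff.2 (hne i p))))
    exact h2.contMDiffAt.comp p ((w i).contMDiff p)
  · ext i
    change (w i (σ.act p z) / ‖w i (σ.act p z)‖ : ℂ) = (w i p / ‖w i p‖ : ℂ) * (z i : ℂ)
    rw [hact, norm_mul, Circle.norm_coe, one_mul, mul_comm, mul_div_right_comm]

end EquivariantMap

/-! ### Equivalence with the trivial bundle -/

section Trivialization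

variable {EP : Type*} [NormedAddCommGroup EP] [NormedSpace ℝ EP] {HP : Type*} [TopologicalSpace HP]
  {IP : ModelWithCorners ℝ EP HP} {P : Type*} [TopologicalSpace P] [ChartedSpace HP P]
  {EM : Type*} [NormedAddCommGroup EM] [NormedSpace ℝ EM] {HM : Type*} [TopologicalSpace HM]
  {IM : ModelWithCorners ℝ EM HM} {M : Type*} [TopologicalSpace M] [ChartedSpace HM M]
  {EG : Type*} [NormedAddCommGroup EG] [NormedSpace ℝ EG] {HG : Type*} [TopologicalSpace HG]
  {IG : ModelWithCorners ℝ EG HG} {G : Type*} [Group G] [TopologicalSpace G] [ChartedSpace HG G]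

/-- A bundle that is equivalent to the trivial one is a principal bundle. -/
theorem BundleEquivalent.isPrincipalBundle {q : P → M} {σ : RightAction P G}
    (hσ : σ.IsSmooth IP IG) (hq : ContMDiff IP IM ∞ q)
    (h : BundleEquivalent IP (IM.prod IG) q σ Prod.fst (RightAction.trivial M G)) :
    IsPrincipalBundle IP IM IG q σ := by
  obtain ⟨φ, hφq, hφσ⟩ := h
  have hq' : ∀ x, q (φ.symm x) = x.1 := fun x => by rw [← hφq, φ.apply_symm_apply]
  refine ⟨hσ, hq, fun m => ⟨⊤, ⊤, trivial, rfl, ⟨⟨⟨fun x => ⟨φ.symm (x.1, x.2), trivial⟩,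
    fun p => (⟨(φ p).1, trivial⟩, (φ p).2), fun x => ?_, fun p => ?_⟩, ?_, ?_⟩, ?_, ?_⟩⟩⟩
  · simp
  · ext
    simp
  · refine (ContMDiff.subtypeVal_comp_iff _ _).1 (φ.symm.contMDiff.comp
      (f := fun x : (⊤ : TopologicalSpace.Opens M) × G => ((x.1 : M), x.2))
      ((contMDiff_subtype_val.comp contMDiff_fst).prodMk contMDiff_snd))
  · have h1 : ContMDiff IP (IM.prod IG) ∞
        fun p : (⊤ : TopologicalSpace.Opens P) => φ p := φ.contMDiff.comp contMDiff_subtype_val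
    exact ContMDiff.prodMk ((ContMDiff.subtypeVal_comp_iff _ _).1 (contMDiff_fst.comp h1))
      (contMDiff_snd.comp h1)
  · exact fun x g => hq' _
  · intro x g k
    change φ.symm (x.1, g * k) = σ.act (φ.symm (x.1, g)) k
    have h1 : φ (φ.symm (x.1, g * k)) = φ (σ.act (φ.symm (x.1, g)) k) := by
      rw [hφσ, φ.apply_symm_apply, φ.apply_symm_apply]
      rfl
    exact φ.injective h1

/-- A smooth section and an equivariant map to the group trivialize a bundle. -/
theorem BundleEquivalent.of_section {q : P → M} {σ : RightAction P G} (hσ : σ.IsSmooth IP IG)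
    (hq : ContMDiff IP IM ∞ q) (hqσ : ∀ p g, q (σ.act p g) = q p)
    (hfib : ∀ p p', q p = q p' → ∃ g, σ.act p g = p') {v : P → G} (hv : ContMDiff IP IG ∞ v)
    (hvσ : ∀ p g, v (σ.act p g) = v p * g) {ρ : M → P} (hρ : ContMDiff IM IP ∞ ρ)
    (hqρ : ∀ m, q (ρ m) = m) (hvρ : ∀ m, v (ρ m) = 1) :
    BundleEquivalent IP (IM.prod IG) q σ Prod.fst (RightAction.trivial M G) := by
  refine ⟨⟨⟨fun p => (q p, v p), fun x => σ.act (ρ x.1) x.2, fun p => ?_, fun x => ?_⟩,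
    hq.prodMk hv, ?_⟩, fun p => rfl, fun p g => ?_⟩
  -- `p` and `ρ (q p)` lie in one orbit; applying `v` to `p = σ (ρ (q p), g)` identifies `g` as `v
  -- p`.
  · obtain ⟨g, hg⟩ := hfib (ρ (q p)) p (hqρ _)
    have h1 : v p = g := by rw [← hg, hvσ, hvρ, one_mul]
    change σ.act (ρ (q p)) (v p) = p
    rw [h1, hg]
  · change (q (σ.act (ρ x.1) x.2), v (σ.act (ρ x.1) x.2)) = x
    rw [hqσ, hqρ, hvσ, hvρ, one_mul]
  · exact ContMDiff.comp (g := fun x : P × G => σ.act x.1 x.2)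
      (f := fun x : M × G => (ρ x.1, x.2)) hσ ((hρ.comp contMDiff_fst).prodMk contMDiff_snd)
  · change (q (σ.act p g), v (σ.act p g)) = (q p, v p * g)
    rw [hqσ, hvσ]

end Trivialization

/-! ### The orbit map and its section -/

namespace RightAction

theorem orbitMap_act {P G : Type*} [Group G] (σ : RightAction P G) (p : P) (g : G) :
    σ.orbitMap (σ.act p g) = σ.orbitMap p :=
  (Quotient.sound (s := σ.orbitSetoid) ⟨g, rfl⟩ : σ.orbitMap p = σ.orbitMap (σ.act p g)).symm

theorem exists_act_eq_of_orbitMap_eq {P G : Type*} [Group G] (σ : RightAction P G) {p p' : P}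
    (h : σ.orbitMap p = σ.orbitMap p') : ∃ g, σ.act p g = p' := Quotient.exact h

theorem orbitMap_surjective {P G : Type*} [Group G] (σ : RightAction P G) :
    Function.Surjective σ.orbitMap := Quotient.mk_surjective

theorem continuous_orbitMap {P G : Type*} [Group G] [TopologicalSpace P] (σ : RightAction P G) :
    Continuous σ.orbitMap := continuous_quotient_mk'

section Section

variable {P G : Type*} [Group G] {σ : RightAction P G} {v : P → G}
  (hv : ∀ p g, v (σ.act p g) = v p * g)

/-- The section of the orbit map defined by an equivariant map to the group. -/
def orbitSection : σ.OrbitSpace → P :=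
  Quotient.lift (fun p => σ.act p (v p)⁻¹) (by
    rintro p _ ⟨g, rfl⟩
    rw [hv, ← σ.act_mul, mul_inv_rev, mul_inv_cancel_left])

theorem orbitSection_orbitMap (p : P) :
    orbitSection hv (σ.orbitMap p) = σ.act p (v p)⁻¹ := rfl

theorem orbitMap_orbitSection (q : σ.OrbitSpace) : σ.orbitMap (orbitSection hv q) = q := by
  obtain ⟨p, rfl⟩ := σ.orbitMap_surjective q
  rw [orbitSection_orbitMap, orbitMap_act]

theorem apply_orbitSection (q : σ.OrbitSpace) : v (orbitSection hv q) = 1 := by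
  obtain ⟨p, rfl⟩ := σ.orbitMap_surjective q
  rw [orbitSection_orbitMap, hv, mul_inv_cancel]

theorem orbitSection_orbitMap_of_eq_one {p : P} (hp : v p = 1) :
    orbitSection hv (σ.orbitMap p) = p := by
  rw [orbitSection_orbitMap, hp, inv_one, σ.act_one]

end Section

end RightAction

section OrbitSpaceManifold

variable {n d : ℕ} {P : Type u} [TopologicalSpace P] [ChartedSpace (EuclideanSpace ℝ (Fin d)) P]
  {σ : RightAction P (Torus n)} {v : P → Torus n}

theorem contMDiff_act_inv (hσ : σ.IsSmooth (𝓡 d) (torusModel n))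
    (hvs : ContMDiff (𝓡 d) (torusModel n) ∞ v) :
    ContMDiff (𝓡 d) (𝓡 d) ∞ fun p => σ.act p (v p)⁻¹ :=
  ContMDiff.comp (g := fun x : P × Torus n => σ.act x.1 x.2) (f := fun p => (p, (v p)⁻¹)) hσ
    (contMDiff_id.prodMk hvs.inv)

theorem continuous_orbitSection (hσ : σ.IsSmooth (𝓡 d) (torusModel n))
    (hvs : ContMDiff (𝓡 d) (torusModel n) ∞ v) (hv : ∀ p z, v (σ.act p z) = v p * z) :
    Continuous (RightAction.orbitSection hv) :=
  continuous_quot_lift _ (contMDiff_act_inv hσ hvs).continuous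

/-- For every structure of a principal bundle, the section is smooth. -/
theorem IsPrincipalBundle.contMDiff_orbitSection {EM : Type*} [NormedAddCommGroup EM]
    [NormedSpace ℝ EM] {HM : Type*} [TopologicalSpace HM] {IM : ModelWithCorners ℝ EM HM}
    [ChartedSpace HM σ.OrbitSpace] (hvs : ContMDiff (𝓡 d) (torusModel n) ∞ v)
    (hv : ∀ p z, v (σ.act p z) = v p * z)
    (h : IsPrincipalBundle (𝓡 d) IM (torusModel n) σ.orbitMap σ) :
    ContMDiff IM (𝓡 d) ∞ (RightAction.orbitSection hv) := by
  intro m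
  obtain ⟨U, V, hm, -, φ, hφ, -⟩ := h.locallyTrivial m
  have h1 : ContMDiff IM (𝓡 d) ∞ fun x : U => RightAction.orbitSection hv (x : σ.OrbitSpace) := by
    -- The smooth local section `x ↦ φ (x, 1)` is moved along the orbits into `v⁻¹(1)`, where it
    -- agrees with the global section.
    have h2 : (fun x : U => RightAction.orbitSection hv (x : σ.OrbitSpace)) = fun x : U =>
        σ.act (φ (x, 1)) (v (φ (x, 1)))⁻¹ := by
      ext1 x
      conv_lhs => rw [← hφ x 1]
      rfl
    rw [h2]
    exact (contMDiff_act_inv h.smooth_act hvs).comp (contMDiff_subtype_val.comp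
      (φ.contMDiff.comp (contMDiff_id.prodMk contMDiff_const)))
  exact contMDiffAt_subtype_iff.1 (h1 ⟨m, hm⟩)

end OrbitSpaceManifold

/-! ### The manifold structure of the orbit space -/

section OrbitSpaceCharts

variable {n d : ℕ} {P : Type u} [TopologicalSpace P] [ChartedSpace (EuclideanSpace ℝ (Fin d)) P]
  [IsManifold (𝓡 d) ∞ P] {σ : RightAction P (Torus n)} {v : P → Torus n}

/-- The imaginary parts of an equivariant map form a submersion where the map is `1`. -/
theorem surjective_fderiv_im (hσ : σ.IsSmooth (𝓡 d) (torusModel n))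
    (hv : ∀ p z, v (σ.act p z) = v p * z) {p₀ : P} (hp₀ : v p₀ = 1)
    {f : EuclideanSpace ℝ (Fin d) → Fin n → ℝ}
    (hf : ∀ y ∈ (chartAt (EuclideanSpace ℝ (Fin d)) p₀).target,
      f y = fun i => (v ((chartAt (EuclideanSpace ℝ (Fin d)) p₀).symm y) i : ℂ).im)
    (hd : DifferentiableAt ℝ f (chartAt (EuclideanSpace ℝ (Fin d)) p₀ p₀)) :
    Function.Surjective (fderiv ℝ f (chartAt (EuclideanSpace ℝ (Fin d)) p₀ p₀)) := by
  set e := chartAt (EuclideanSpace ℝ (Fin d)) p₀ with he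
  have horb : ContMDiff 𝓘(ℝ, Fin n → ℝ) (𝓡 d) ∞ fun s => σ.act p₀ (Torus.exp s) :=
    ContMDiff.comp (g := fun x : P × Torus n => σ.act x.1 x.2)
      (f := fun s => (p₀, Torus.exp s)) hσ (contMDiff_const.prodMk Torus.contMDiff_exp)
  have h0 : σ.act p₀ (Torus.exp 0) = p₀ := by rw [Torus.exp_zero, σ.act_one]
  have hec : ContMDiffAt (𝓡 d) (𝓡 d) ∞ e (σ.act p₀ (Torus.exp 0)) := by
    rw [h0]
    exact contMDiffAt_of_mem_maximalAtlas
      (IsManifold.subset_maximalAtlas (chart_mem_atlas _ p₀)) (mem_chart_source _ p₀)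
  have hγ : ContDiffAt ℝ ∞ (fun s => e (σ.act p₀ (Torus.exp s))) 0 :=
    (hec.comp (0 : Fin n → ℝ) (horb 0)).contDiffAt
  have hγ' := (hγ.differentiableAt (by simp)).hasFDerivAt
  have hf' : HasFDerivAt f (fderiv ℝ f (e p₀)) (e (σ.act p₀ (Torus.exp 0))) := by
    rw [h0]
    exact hd.hasFDerivAt
  have h1 := hf'.comp (0 : Fin n → ℝ) hγ'
  -- By equivariance `v` equals `exp s` at `σ (p₀, exp s)`, so `f` restricted to the orbit is `sin`
  -- in each coordinate. Its derivative at 0 is the identity, which exhibits a right inverse of the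
  -- derivative of `f`.
  have h2 : HasFDerivAt (fun s : Fin n → ℝ => fun i => Real.sin (s i))
      (ContinuousLinearMap.id ℝ (Fin n → ℝ)) 0 := by
    refine hasFDerivAt_pi'.2 fun i => ?_
    have h3 := (Real.hasDerivAt_sin ((0 : Fin n → ℝ) i)).comp_hasFDerivAt (0 : Fin n → ℝ)
      (ContinuousLinearMap.proj (R := ℝ) (φ := fun _ : Fin n => ℝ) i).hasFDerivAt
    rw [Pi.zero_apply, Real.cos_zero, one_smul] at h3
    exact h3
  have h3 : (f ∘ fun s => e (σ.act p₀ (Torus.exp s))) =ᶠ[𝓝 0]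
      fun s : Fin n → ℝ => fun i => Real.sin (s i) := by
    have hm : ∀ᶠ s in 𝓝 (0 : Fin n → ℝ), σ.act p₀ (Torus.exp s) ∈ e.source :=
      horb.continuous.continuousAt.eventually
        (e.open_source.mem_nhds (by
          change σ.act p₀ (Torus.exp 0) ∈ e.source
          rw [h0]
          exact mem_chart_source _ p₀))
    filter_upwards [hm] with s hs
    rw [Function.comp_apply, hf _ (e.map_source hs), e.left_inv hs, hv, hp₀, one_mul]
    ext i
    change (Circle.exp (s i) : ℂ).im = _
    rw [Circle.coe_exp, Complex.exp_ofReal_mul_I_im]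
  have h4 := h1.unique (h2.congr_of_eventuallyEq h3)
  intro w
  exact ⟨_, congrArg (fun T : (Fin n → ℝ) →L[ℝ] (Fin n → ℝ) => T w) h4⟩

/-- Charts of the orbit space, with smooth local sections. -/
theorem exists_orbitSpace_chart (hσ : σ.IsSmooth (𝓡 d) (torusModel n))
    (hvs : ContMDiff (𝓡 d) (torusModel n) ∞ v) (hv : ∀ p z, v (σ.act p z) = v p * z)
    (q₀ : σ.OrbitSpace) :
    ∃ χ : OpenPartialHomeomorph σ.OrbitSpace (EuclideanSpace ℝ (Fin (d - n))), q₀ ∈ χ.source ∧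
      ContMDiffOn (𝓡 d) (𝓡 (d - n)) ∞ (χ ∘ σ.orbitMap) (σ.orbitMap ⁻¹' χ.source) ∧
      ContMDiffOn (𝓡 (d - n)) (𝓡 d) ∞ (RightAction.orbitSection hv ∘ χ.symm) χ.target := by
  set ρ := RightAction.orbitSection hv with hρ
  have hρc : Continuous ρ := continuous_orbitSection hσ hvs hv
  set p₀ := ρ q₀ with hp₀
  have he := chart_mem_atlas (EuclideanSpace ℝ (Fin d)) p₀
  set e := chartAt (EuclideanSpace ℝ (Fin d)) p₀ with hedef
  have hesymm := contMDiffOn_symm_of_mem_maximalAtlas (I := 𝓡 d) (n := ∞)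
    (IsManifold.subset_maximalAtlas he)
  have hesm := contMDiffOn_of_mem_maximalAtlas (I := 𝓡 d) (n := ∞)
    (IsManifold.subset_maximalAtlas he)
  have hp₀e : p₀ ∈ e.source := mem_chart_source _ p₀
  have hcoe : ∀ i, ContMDiff (𝓡 d) 𝓘(ℝ, ℂ) ∞ fun p => (v p i : ℂ) := fun i =>
    Circle.contMDiff_coe.comp ((Torus.contMDiff_apply n i).comp hvs)
  set f : EuclideanSpace ℝ (Fin d) → Fin n → ℝ := fun y i => (v (e.symm y) i : ℂ).im with hf
  have hfs : ContDiffOn ℝ ∞ f e.target := contDiffOn_pi.2 fun i =>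
    ((Complex.imCLM.contDiff.contMDiff.comp (hcoe i)).comp_contMDiffOn hesymm).contDiffOn
  have hfd := (hfs.contDiffAt (e.open_target.mem_nhds (e.map_source hp₀e))).differentiableAt
    (by simp)
  obtain ⟨A, hA⟩ := ContinuousLinearMap.exists_equiv_prod_of_surjective _
    (surjective_fderiv_im hσ hv (RightAction.apply_orbitSection hv q₀) (fun _ _ => rfl) hfd)
  -- Local coordinates that straighten `v⁻¹(1)` to `{0} × ℝ^(d-n)`: `f` is completed by the second
  -- component of `A`, so that `A` is the derivative at the base point.
  set Θ : EuclideanSpace ℝ (Fin d) → (Fin n → ℝ) × EuclideanSpace ℝ (Fin (d - n)) :=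
    fun y => (f y, (A y).2) with hΘ
  have hΘs : ContDiffOn ℝ ∞ Θ e.target := hfs.prodMk (contDiff_snd.comp A.contDiff).contDiffOn
  have hΘA : HasFDerivAt Θ (A : EuclideanSpace ℝ (Fin d) →L[ℝ] _) (e p₀) := by
    have h1 := hfd.hasFDerivAt.prodMk
      (((ContinuousLinearMap.snd ℝ (Fin n → ℝ) (EuclideanSpace ℝ (Fin (d - n)))).comp
        (A : EuclideanSpace ℝ (Fin d) →L[ℝ] _)).hasFDerivAt (x := e p₀))
    have h2 : (A : EuclideanSpace ℝ (Fin d) →L[ℝ] _) = (fderiv ℝ f (e p₀)).prod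
        ((ContinuousLinearMap.snd ℝ (Fin n → ℝ) (EuclideanSpace ℝ (Fin (d - n)))).comp
          (A : EuclideanSpace ℝ (Fin d) →L[ℝ] _)) :=
      ContinuousLinearMap.ext fun x => Prod.ext (hA x) rfl
    rw [h2]
    exact h1
  have hre : ContinuousOn (fun y => fun i => (v (e.symm y) i : ℂ).re) e.target :=
    continuousOn_pi.2 fun i => Complex.continuous_re.comp_continuousOn
      ((hcoe i).continuous.comp_continuousOn e.continuousOn_symm)
  have hpos : IsOpen {w : Fin n → ℝ | ∀ i, 0 < w i} := by
    simp only [Set.ofPred_forall]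
    exact isOpen_iInter_of_finite fun i => isOpen_lt continuous_const (continuous_apply i)
  -- The imaginary part of `v i` vanishes at `-1` as well as at 1; positive real parts exclude `-1`,
  -- so that `f = 0` means `v = 1` on `O`.
  set O := e.target ∩ (fun y => fun i => (v (e.symm y) i : ℂ).re) ⁻¹' {w | ∀ i, 0 < w i} with hO
  have hOo : IsOpen O := hre.isOpen_inter_preimage e.open_target hpos
  have hmO : e p₀ ∈ O := by
    refine ⟨e.map_source hp₀e, fun i => ?_⟩
    change 0 < (v (e.symm (e p₀)) i : ℂ).re
    rw [e.left_inv hp₀e, hp₀, RightAction.apply_orbitSection hv]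
    simp
  obtain ⟨Ψ, hΨm, hΨO, hΨΘ, hΨs⟩ :=
    (hΘs.mono Set.inter_subset_left).exists_openPartialHomeomorph hOo hmO hΘA
  have hone : ∀ y ∈ O, f y = 0 → v (e.symm y) = 1 := by
    intro y hy hfy
    ext i
    have h1 : (v (e.symm y) i : ℂ).im = 0 := congrFun hfy i
    have h2 : 0 < (v (e.symm y) i : ℂ).re := hy.2 i
    have h3 := Circle.norm_coe (v (e.symm y) i)
    have h4 : (v (e.symm y) i : ℂ) = ((v (e.symm y) i : ℂ).re : ℂ) :=
      Complex.ext rfl (by rw [h1, Complex.ofReal_im])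
    rw [h4, Complex.norm_real, Real.norm_of_nonneg h2.le] at h3
    rw [h4, h3]
    simp
  have hfρ : ∀ q, ρ q ∈ e.source → f (e (ρ q)) = 0 := by
    intro q hq
    ext i
    change (v (e.symm (e (ρ q))) i : ℂ).im = 0
    rw [e.left_inv hq, RightAction.apply_orbitSection hv]
    simp
  have hinv : ∀ y : EuclideanSpace ℝ (Fin (d - n)), ((0 : Fin n → ℝ), y) ∈ Ψ.target →
      Ψ.symm (0, y) ∈ O ∧ v (e.symm (Ψ.symm (0, y))) = 1 ∧
        (A (Ψ.symm (0, y))).2 = y := by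
    intro y hy
    have h1 := hΨO (Ψ.map_target hy)
    have h2 : Θ (Ψ.symm (0, y)) = (0, y) := by
      rw [← hΨΘ]
      exact Ψ.right_inv hy
    exact ⟨h1, hone _ h1 (congrArg Prod.fst h2), congrArg Prod.snd h2⟩
  have hρinv : ∀ y : EuclideanSpace ℝ (Fin (d - n)), ((0 : Fin n → ℝ), y) ∈ Ψ.target →
      ρ (σ.orbitMap (e.symm (Ψ.symm (0, y)))) = e.symm (Ψ.symm (0, y)) := fun y hy =>
    RightAction.orbitSection_orbitMap_of_eq_one hv (hinv y hy).2.1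
  have hΘρ : ∀ q, ρ q ∈ e.source → Ψ (e (ρ q)) = (0, (A (e (ρ q))).2) := fun q hq => by
    rw [hΨΘ]
    exact Prod.ext (hfρ q hq) rfl
  have hsrc : IsOpen (e.source ∩ e ⁻¹' Ψ.source) :=
    e.continuousOn.isOpen_inter_preimage e.open_source Ψ.open_source
  have hzero : Continuous fun y : EuclideanSpace ℝ (Fin (d - n)) => ((0 : Fin n → ℝ), y) :=
    continuous_const.prodMk continuous_id
  -- An orbit is represented by its point in `v⁻¹(1)`, and the chart is the second component of the
  -- straightened coordinates of this point.
  let χ : OpenPartialHomeomorph σ.OrbitSpace (EuclideanSpace ℝ (Fin (d - n))) :=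
    { toFun := fun q => (A (e (ρ q))).2
      invFun := fun y => σ.orbitMap (e.symm (Ψ.symm (0, y)))
      source := ρ ⁻¹' (e.source ∩ e ⁻¹' Ψ.source)
      target := {y | ((0 : Fin n → ℝ), y) ∈ Ψ.target}
      map_source' := fun q hq => by
        change ((0 : Fin n → ℝ), (A (e (ρ q))).2) ∈ Ψ.target
        rw [← hΘρ q hq.1]
        exact Ψ.map_source hq.2
      map_target' := fun y hy => by
        change ρ (σ.orbitMap (e.symm (Ψ.symm (0, y)))) ∈ e.source ∩ e ⁻¹' Ψ.source
        rw [hρinv y hy]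
        refine ⟨e.map_target (hinv y hy).1.1, ?_⟩
        rw [Set.mem_preimage, e.right_inv (hinv y hy).1.1]
        exact Ψ.map_target hy
      left_inv' := fun q hq => by
        rw [← hΘρ q hq.1, Ψ.left_inv hq.2, e.left_inv hq.1]
        exact RightAction.orbitMap_orbitSection hv q
      right_inv' := fun y hy => by
        rw [hρinv y hy, e.right_inv (hinv y hy).1.1, (hinv y hy).2.2]
      open_source := hsrc.preimage hρc
      open_target := Ψ.open_target.preimage hzero
      continuousOn_toFun := (continuous_snd.comp A.continuous).comp_continuousOn
        (e.continuousOn.comp hρc.continuousOn fun q hq => hq.1)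
      continuousOn_invFun := σ.continuous_orbitMap.comp_continuousOn
        (e.continuousOn_symm.comp (Ψ.continuousOn_symm.comp hzero.continuousOn fun y hy => hy)
          fun y hy => (hinv y hy).1.1) }
  refine ⟨χ, ⟨hp₀e, hΨm⟩, ?_, ?_⟩
  · have h1 : ContDiff ℝ ∞ fun y : EuclideanSpace ℝ (Fin d) => (A y).2 :=
      contDiff_snd.comp A.contDiff
    exact h1.contMDiff.comp_contMDiffOn
      (hesm.comp (contMDiff_act_inv hσ hvs).contMDiffOn fun p hp => hp.1)
  · have h1 : ContDiffOn ℝ ∞ (fun y : EuclideanSpace ℝ (Fin (d - n)) =>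
        Ψ.symm ((0 : Fin n → ℝ), y)) χ.target :=
      hΨs.comp (contDiff_const.prodMk contDiff_id).contDiffOn fun y hy => hy
    refine (hesymm.comp h1.contMDiffOn fun y hy => (hinv y hy).1.1).congr fun y hy => ?_
    exact hρinv y hy

/-- The orbit space of a free torus action with an equivariant map to the torus is a manifold,
and the orbit map is a principal bundle. -/
theorem exists_chartedSpace_orbitSpace (hσ : σ.IsSmooth (𝓡 d) (torusModel n))
    (hvs : ContMDiff (𝓡 d) (torusModel n) ∞ v) (hv : ∀ p z, v (σ.act p z) = v p * z) :
    ∃ _ : ChartedSpace (EuclideanSpace ℝ (Fin (d - n))) σ.OrbitSpace,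
      IsManifold (𝓡 (d - n)) ∞ σ.OrbitSpace ∧
      IsPrincipalBundle (𝓡 d) (𝓡 (d - n)) (torusModel n) σ.orbitMap σ := by
  choose χ hχm hχs hχt using exists_orbitSpace_chart hσ hvs hv
  set ρ := RightAction.orbitSection hv with hρ
  have hprρ := RightAction.orbitMap_orbitSection hv
  let cs : ChartedSpace (EuclideanSpace ℝ (Fin (d - n))) σ.OrbitSpace :=
    { atlas := Set.range χ
      chartAt := χ
      mem_chart_source := hχm
      chart_mem_atlas := fun q => ⟨q, rfl⟩ }
  have hman : IsManifold (𝓡 (d - n)) ∞ σ.OrbitSpace := by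
    refine isManifold_of_contDiffOn _ _ _ ?_
    rintro _ _ ⟨q, rfl⟩ ⟨q', rfl⟩
    -- A change of charts factors through `P`, by the section followed by the orbit map, both of
    -- which are smooth in charts.
    have h1 : ContMDiffOn (𝓡 (d - n)) (𝓡 (d - n)) ∞
        ((χ q' ∘ σ.orbitMap) ∘ (ρ ∘ (χ q).symm)) ((χ q).symm.trans (χ q')).source :=
      (hχs q').comp ((hχt q).mono fun y hy => hy.1) fun y hy => by
        change σ.orbitMap (ρ ((χ q).symm y)) ∈ (χ q').source
        rw [hprρ]
        exact hy.2
    refine (h1.contDiffOn.mono fun y hy => hy.1).congr fun y _ => ?_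
    change χ q' ((χ q).symm y) = χ q' (σ.orbitMap (ρ ((χ q).symm y)))
    rw [hprρ]
  have hpr : ContMDiff (𝓡 d) (𝓡 (d - n)) ∞ σ.orbitMap := by
    intro p
    rw [contMDiffAt_iff_target]
    refine ⟨σ.continuous_orbitMap.continuousAt, ?_⟩
    exact (hχs (σ.orbitMap p)).contMDiffAt (((χ (σ.orbitMap p)).open_source.preimage
      σ.continuous_orbitMap).mem_nhds (hχm _))
  have hρs : ContMDiff (𝓡 (d - n)) (𝓡 d) ∞ ρ := by
    intro q
    have h1 : ContMDiffOn (𝓡 (d - n)) (𝓡 d) ∞ ((ρ ∘ (χ q).symm) ∘ χ q) (χ q).source :=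
      (hχt q).comp (contMDiffOn_of_mem_maximalAtlas
        (IsManifold.subset_maximalAtlas ⟨q, rfl⟩)) (χ q).mapsTo
    refine (h1.contMDiffAt ((χ q).open_source.mem_nhds (hχm q))).congr_of_eventuallyEq ?_
    filter_upwards [(χ q).open_source.mem_nhds (hχm q)] with q' hq'
    simp only [Function.comp_apply, (χ q).left_inv hq']
  exact ⟨cs, hman, (BundleEquivalent.of_section hσ hpr σ.orbitMap_act
    (fun _ _ => σ.exists_act_eq_of_orbitMap_eq) hvs hv hρs hprρ
    (RightAction.apply_orbitSection hv)).isPrincipalBundle hσ hpr⟩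

end OrbitSpaceCharts

end

/-! ### The theorem -/

theorem mainTheorem2 (n d : ℕ) {P : Type*} [TopologicalSpace P] [T2Space P]
    [SecondCountableTopology P] [ChartedSpace (EuclideanSpace ℝ (Fin d)) P]
    [IsManifold (𝓡 d) ∞ P] :
    (∀ α : Torus n →* (SmoothFn d P ≃ₐ[ℂ] SmoothFn d P),
      IsSmoothTrivialNCPTorusBundle α →
      ∃ σ : RightAction P (Torus n),
        IsInducedAction α σ ∧
        (∀ σ' : RightAction P (Torus n), IsInducedAction α σ' → σ' = σ) ∧
        (∃ (m : ℕ) (_ : ChartedSpace (EuclideanSpace ℝ (Fin m)) σ.OrbitSpace),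
          T2Space σ.OrbitSpace ∧ SecondCountableTopology σ.OrbitSpace ∧
          IsManifold (𝓡 m) ∞ σ.OrbitSpace ∧
          IsPrincipalBundle (𝓡 d) (𝓡 m) (torusModel n) σ.orbitMap σ) ∧
        (∀ (m : ℕ) [ChartedSpace (EuclideanSpace ℝ (Fin m)) σ.OrbitSpace]
          [IsManifold (𝓡 m) ∞ σ.OrbitSpace],
          IsPrincipalBundle (𝓡 d) (𝓡 m) (torusModel n) σ.orbitMap σ →
          IsTrivialPrincipalBundle (𝓡 d) (𝓡 m) (torusModel n) σ.orbitMap σ)) ∧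
    (∀ (m : ℕ) (M : Type*) [TopologicalSpace M] [T2Space M] [SecondCountableTopology M]
      [ChartedSpace (EuclideanSpace ℝ (Fin m)) M] [IsManifold (𝓡 m) ∞ M]
      (q : P → M) (σ : RightAction P (Torus n)) (hσ : σ.IsSmooth (𝓡 d) (torusModel n)),
      IsTrivialPrincipalBundle (𝓡 d) (𝓡 m) (torusModel n) q σ →
      IsSmoothTrivialNCPTorusBundle (functionAction σ hσ)) := by
  refine ⟨fun α hα => ?_, fun m M _ _ _ _ _ q σ hσ h =>
    isSmoothTrivialNCPTorusBundle_functionAction hσ h⟩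
  obtain ⟨σ, hσ⟩ := exists_isInducedAction α
  have hs := hσ.isSmooth hα.smooth
  obtain ⟨v, hvs, hv⟩ := hα.exists_equivariant hσ
  refine ⟨σ, hσ, fun σ' h' => hσ.unique h', ?_, ?_⟩
  · obtain ⟨cs, hman, hpb⟩ := exists_chartedSpace_orbitSpace hs hvs hv
    -- A continuous section embeds the orbit space into `P`, from which it inherits the Hausdorff
    -- property and second countability.
    have hemb : Topology.IsEmbedding (RightAction.orbitSection hv) :=
      .of_leftInverse (RightAction.orbitMap_orbitSection hv) σ.continuous_orbitMap
        (continuous_orbitSection hs hvs hv)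
    -- If `P` is nonempty, then `n ≤ d` by the submersion property; truncation of `d - n` can only
    -- occur for empty `P`.
    exact ⟨d - n, cs, hemb.t2Space, hemb.secondCountableTopology, hman, hpb⟩
  · intro m _ _ hpb
    exact ⟨hpb, .of_section hs hpb.smooth_proj σ.orbitMap_act
      (fun _ _ => σ.exists_act_eq_of_orbitMap_eq) hvs hv
      (hpb.contMDiff_orbitSection hvs hv) (RightAction.orbitMap_orbitSection hv)
      (RightAction.apply_orbitSection hv)⟩
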